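/- **Setting.** Let $k$ be a commutative ring and $\mathfrak a$ a graded $k$-quiver: a collection of objects with $\mathbb Z$-graded $k$-modules $\mathfrak a(A,A')$. Let $\Sigma$ be the shift, $(\Sigma^sV)^e=V^{e+s}$. The Hochschild object is $\mathbf C(\mathfrak a)=\Sigma^{-1}\mathbf C_{br}(\mathfrak a)$, where $\mathbf C_{br}(\mathfrak a)=\prod_{n\ge0}\prod_{A_0,\dots,A_n}[\Sigma\mathfrak a(A_{n-1},A_n)\otimes\cdots\otimes\Sigma\mathfrak a(A_0,A_1),\Sigma\mathfrak a(A_0,A_n)]$ is a brace algebra under $$\phi\{\phi_1,\dots,\phi_r\}=\sum\phi(1\otimes\cdots\otimes\phi_1\otimes1\otimes\cdots\otimes\phi_r\otimes1\otimes\cdots\otimes1)$$ with Koszul signs. Thus $\mathbf C^{p+1}(\mathfrak a)=\mathbf C_{br}^{p}(\mathfrak a)$; braces and signs are always those of $\mathbf C_{br}$. An $A_{[0,\infty[}$-structure on $\mathfrak a$ is an element $\mu\in\mathbf C^2(\mathfrak a)=\mathbf C^1_{br}(\mathfrak a)$ with $\mu\{\mu\}=0$. It is a cdg structure if its components $\mu_n$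 of arity $n$ vanish for $n\ge3$, and a dg structure if moreover $\mu_0=0$. An $A_{[0,\infty[}$-structure $\mu$ makes $\mathbf C(\mathfrak a)$ a $B_\infty$-algebra, with the braces and the operations $D_1(\phi)=\mu\{\phi\}-(-1)^{|\phi|}\phi\{\mu\}$ ($|\phi|$ the degree in $\mathbf C_{br}$) and $D_n(\phi_1,\dots,\phi_n)=\mu\{\phi_1,\dots,\phi_n\}$ for $n>1$. A $B_\infty$-morphism is a graded $k$-linear map of degree $0$ commuting with all braces and all $D_n$. **Twisted objects.** An object of $\mathsf{Tw_{free}}(\mathfrak a)$ is a pair $(M,\delta_M)$ of a formal coproduct $M=\bigoplus_{i\in I}\Sigma^{m_i}A_i$ ($I$ an arbitrary set, $m_i\in\mathbb Z$, $A_i\in\mathfrak a$) and an element $\delta_M$ of degree $1$ of $\mathrm{Hom}(M,M)$, where $\mathrm{Hom}(M,N)=\prod_i\bigoplus_j\Sigma^{n_j-m_i}\mathfrak a(A_i,B_j)$ for $N=\bigoplus_{j}\Sigma^{n_j}B_j$; these $\mathrm{Hom}$'s are the morphisms of $\mathsf{Tw_{free}}(\mathfrak a)$. Let $\mathsf{Tw}(\mathfrak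 a)$ be the full subquiver on some collection of such objects, and let $\delta\in\mathbf C^1(\mathsf{Tw}(\mathfrak a))$ be the arity-zero cochain with components $\delta_M$. A cochain $\phi\in\mathbf C(\mathfrak a)$ is also regarded as a cochain on $\mathsf{Tw}(\mathfrak a)$ by the matrix formula $$\phi(f_n,\dots,f_1)_{ji}=\sum_{k_1,\dots,k_{n-1}}\pm\,\phi((f_n)_{jk_{n-1}},\dots,(f_1)_{k_1i}),$$ with the Koszul signs of the canonical isomorphisms $[\bigotimes_l\mathfrak a(A_{l-1},A_l),\mathfrak a(A_0,A_n)]\cong[\bigotimes_l\Sigma^{s_l}\mathfrak a(A_{l-1},A_l),\Sigma^{\sum s_l}\mathfrak a(A_0,A_n)]$. Suppose that every $\mathfrak a(A,A')^d$ is a Hausdorff topological $k$-module (addition, negation and multiplication by each scalar are continuous), for instance a discrete one. From here on $\mathbf C(\mathfrak a)$ denotes the cochains on $\mathfrak a$ all of whose multilinear components are continuous; these are all cochains if $\mathfrak a$ is discrete. No continuity is required of the cochains in $\mathbf C(\mathsf{Tw}(\mathfrak a))$. Assume that $\mathsf{Tw}(\mathfrak a)$ is a quiver of twisted objects: for all homogeneous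 $\phi\in\mathbf C(\mathfrak a)$, all composable homogeneous $(f_n,\dots,f_1)$ in $\mathsf{Tw}(\mathfrak a)$ and every index $i$ of the source of $f_1$ (of the object at which the cochain is evaluated, if $n=0$), the $i$-th columns of $\phi\{\delta^{\otimes m}\}(f_n,\dots,f_1)$, $m\ge0$, are supported in a common finite set of row indices and form a series that converges entrywise. For discrete $\mathfrak a$ this says that the $i$-th column of $\phi\{\delta^{\otimes m}\}(f_n,\dots,f_1)$ vanishes for all large $m$, i.e. that $\mathsf{Tw}(\mathfrak a)$ is a quiver of locally nilpotent twisted objects. **Proposition.** The pointwise series $$\mathrm{embr}_\delta(\phi)=\sum_{m=0}^\infty\phi\{\delta^{\otimes m}\}$$ defines a map $\mathrm{embr}_\delta:\mathbf C(\mathfrak a)\to\mathbf C(\mathsf{Tw}(\mathfrak a))$, and the following hold. 1. If $\mu\in\mathbf C^2(\mathfrak a)$ is an $A_{[0,\infty[}$-structure on $\mathfrak a$, then $\mathrm{embr}_\delta(\mu)$ is an $A_{[0,\infty[}$-structure on $\mathsf{Tw}(\mathfrak a)$, and $\mathrm{embr}_\delta:\mathbf C(\mathfrak a)\to\mathbf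 C(\mathsf{Tw}(\mathfrak a))$ is a $B_\infty$-morphism for the $B_\infty$-structures determined by $\mu$ and $\mathrm{embr}_\delta(\mu)$. 2. If $\mu=c+d+m\in\mathbf C^2(\mathfrak a)$, with $c,d,m$ of arity $0,1,2$, is a cdg structure on $\mathfrak a$, then $$\mathrm{embr}_\delta(\mu)=(c+d\{\delta\}+m\{\delta,\delta\})+(d+m\{\delta\})+m,$$ the three summands have arity $0$, $1$ and $2$, and this is a cdg structure on $\mathsf{Tw}(\mathfrak a)$. 3. If $\mu=d+m\in\mathbf C^2(\mathfrak a)$, with $d,m$ of arity $1,2$, is a dg structure on $\mathfrak a$ and $d\{\delta\}+m\{\delta,\delta\}=0$ in $\mathbf C(\mathsf{Tw}(\mathfrak a))$, then $\mathrm{embr}_\delta(\mu)=(d+m\{\delta\})+m$, and this is a dg structure on $\mathsf{Tw}(\mathfrak a)$. -/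

import Mathlib

open Filter Topology

universe u v w

namespace TwistedObjects

/-! ### Graded quivers and their Hochschild objects

A graded `k`-quiver is given by a type `Ob` of objects and a family `H A B d` of `k`-modules: the
degree `d` part of the graded object of morphisms from `A` to `B`. All signs are Koszul signs for
the suspended quiver: a morphism `f` in `H A B d`, seen as `σ f`, has degree `d - 1`. -/

section Quiver

variable {Ob : Type u} (H : Ob → Ob → ℤ → Type v)

/-- Composable strings `(f_n, …, f_1)` of homogeneous morphisms `f_i : A_{i-1} → A_i` from `A_0`
to `A_n`. The outermost `cons` carries `f_n`, the leftmost tensor factor. -/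
inductive HPath : Ob → Ob → Type (max u v)
  | nil (A : Ob) : HPath A A
  | cons {A B C : Ob} {d : ℤ} (f : H B C d) (q : HPath A B) : HPath A C

/-- Families of functions sending a string from `A` to `B` to an element of `∏ e, H A B e`.
The Hochschild cochains are singled out among them by `IsCochain`. -/
abbrev RawCochain : Type (max u v) := ∀ A B : Ob, HPath H A B → ∀ e : ℤ, H A B e

variable {H}

namespace HPath

/-- The number of morphisms in a string. -/
def length {A B : Ob} : HPath H A B → ℕ
  | nil _ => 0
  | cons _ q => length q + 1

/-- The degree of `σ f_n ⊗ … ⊗ σ f_1`, which is the sum of the `|f_i| - 1`. -/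
def sdeg {A B : Ob} : HPath H A B → ℤ
  | nil _ => 0
  | @cons _ _ _ _ _ d _ q => (d - 1) + sdeg q

/-- Concatenation: `comp r q` has `r` on the left of `q`. -/
def comp {A B C : Ob} : HPath H B C → HPath H A B → HPath H A C
  | nil _, q => q
  | cons f r, q => cons f (comp r q)

/-- All `n + 1` ways to cut a string of length `n` into a left and a right part. -/
def splits {A B : Ob} : HPath H A B → List (Σ C : Ob, HPath H C B × HPath H A C)
  | nil A => [⟨A, nil A, nil A⟩]
  | cons f q => ⟨_, nil _, cons f q⟩ :: (splits q).map fun s => ⟨s.1, cons f s.2.1, s.2.2⟩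

/-- The string `(f_n, …, f_1)` of a family of morphisms `f_{i+1} : A_i → A_{i+1}`. -/
def ofFn : ∀ (n : ℕ) (A : Fin (n + 1) → Ob) (d : Fin n → ℤ),
    (∀ i : Fin n, H (A i.castSucc) (A i.succ) (d i)) → HPath H (A 0) (A (Fin.last n))
  | 0, A, _, _ => nil (A 0)
  | n + 1, A, d, f => cons (f (Fin.last n))
      (ofFn n (fun i => A i.castSucc) (fun i => d i.castSucc) (fun i => f i.castSucc))

end HPath

/-- `IsCochain k p φ`: `φ` is an element of degree `p` of `C_br(a) = [T(Σ a), Σ a]`, that is, an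
element of degree `p + 1` of the Hochschild object `C(a) = Σ⁻¹ C_br(a)`. It is a family, over all
`A_0, …, A_n` with `n ≥ 0` and all degrees, of `k`-multilinear maps
`a(A_{n-1}, A_n) × … × a(A_0, A_1) → a(A_0, A_n)` of degree `p` with respect to the suspended
degrees. The value in `∏ e, a(A_0, A_n)^e` is concentrated in the one degree `e` with
`e - 1 = ∑ (|f_i| - 1) + p`. -/
structure IsCochain (k : Type*) [CommRing k] [∀ A B d, AddCommGroup (H A B d)]
    [∀ A B d, Module k (H A B d)] (p : ℤ) (φ : RawCochain H) : Prop where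
  eq_zero : ∀ (A B : Ob) (q : HPath H A B) (e : ℤ), e ≠ q.sdeg + p + 1 → φ A B q e = 0
  map_add : ∀ (A B C D : Ob) (r : HPath H C D) (q : HPath H A B) (d : ℤ) (f g : H B C d) (e : ℤ),
    φ A D (r.comp (.cons (f + g) q)) e
      = φ A D (r.comp (.cons f q)) e + φ A D (r.comp (.cons g q)) e
  map_smul : ∀ (A B C D : Ob) (r : HPath H C D) (q : HPath H A B) (d : ℤ) (c : k) (f : H B C d)
    (e : ℤ), φ A D (r.comp (.cons (c • f) q)) e = c • φ A D (r.comp (.cons f q)) e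

/-- `φ` has only a component of arity `n`. -/
def HasArity [∀ A B d, AddCommGroup (H A B d)] (n : ℕ) (φ : RawCochain H) : Prop :=
  ∀ (A B : Ob) (q : HPath H A B), q.length ≠ n → φ A B q = 0

/-- All multilinear components of `φ` are (jointly) continuous. This is no condition when all
`H A B d` are discrete. -/
def IsContinuous [∀ A B d, TopologicalSpace (H A B d)] (φ : RawCochain H) : Prop :=
  ∀ (n : ℕ) (A : Fin (n + 1) → Ob) (d : Fin n → ℤ) (e : ℤ),
    Continuous fun f : ∀ i : Fin n, H (A i.castSucc) (A i.succ) (d i) =>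
      φ _ _ (HPath.ofFn n A d f) e

/-- The continuous Hochschild cochains of degree `p`; for a discrete quiver, all of them. -/
def IsContCochain (k : Type*) [CommRing k] [∀ A B d, AddCommGroup (H A B d)]
    [∀ A B d, Module k (H A B d)] [∀ A B d, TopologicalSpace (H A B d)]
    (p : ℤ) (φ : RawCochain H) : Prop :=
  IsCochain k p φ ∧ IsContinuous φ

/-! ### Braces -/

/-- Apply `ψ.2` (of degree `ψ.1`) to a left part of the string, and `rest` (standing for an
operator of degree `w`) to the remaining right part. -/
def placeLeft (ψ : ℤ × RawCochain H) (w : ℤ)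
    (rest : ∀ A B : Ob, HPath H A B → List (ℤˣ × HPath H A B)) {A B : Ob} (q : HPath H A B) :
    List (ℤˣ × HPath H A B) :=
  q.splits.flatMap fun s => (rest A s.1 s.2.2).map fun x =>
    ((w * s.2.1.sdeg).negOnePow * x.1,
      .cons (ψ.2 s.1 B s.2.1 (s.2.1.sdeg + ψ.1 + 1)) x.2)

/-- Leave a number of morphisms on the left untouched, then proceed as in `placeLeft`. -/
def insertFirst (ψ : ℤ × RawCochain H) (w : ℤ)
    (rest : ∀ A B : Ob, HPath H A B → List (ℤˣ × HPath H A B)) :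
    ∀ {A B : Ob}, HPath H A B → List (ℤˣ × HPath H A B)
  | _, _, .nil A => placeLeft ψ w rest (.nil A)
  | _, _, @HPath.cons _ _ _ _ _ d f q => placeLeft ψ w rest (.cons f q) ++
      (insertFirst ψ w rest q).map fun x => (((ψ.1 + w) * (d - 1)).negOnePow * x.1, .cons f x.2)

/-- The signed strings whose sum is
`∑ (1 ⊗ … ⊗ ψ_1 ⊗ 1 ⊗ … ⊗ ψ_m ⊗ 1 ⊗ … ⊗ 1)(σ f_n ⊗ … ⊗ σ f_1)`. The list consists of pairs (degree,
cochain). The Koszul sign rule says that `ψ_j` picks up `(-1) ^ (|ψ_j| (|f_i| - 1))` for every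
`f_i` on the left of the block to which it is applied. -/
def insertions : List (ℤ × RawCochain H) → ∀ A B : Ob, HPath H A B → List (ℤˣ × HPath H A B)
  | [], _, _, q => [(1, q)]
  | ψ :: ψs, _, _, q => insertFirst ψ (ψs.map Prod.fst).sum (insertions ψs) q

variable [∀ A B d, AddCommGroup (H A B d)]

/-- The brace `φ{ψ_1, …, ψ_m} = ∑ φ(1 ⊗ … ⊗ ψ_1 ⊗ 1 ⊗ … ⊗ ψ_m ⊗ 1 ⊗ … ⊗ 1)`. -/
def brace (φ : RawCochain H) (ψs : List (ℤ × RawCochain H)) : RawCochain H :=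
  fun A B q e => ((insertions ψs A B q).map fun x => x.1 • φ A B x.2 e).sum

/-! ### `A_[0,∞[`-structures and `B_∞`-morphisms -/

/-- `A_[0,∞[`-structures: elements `b` of degree `1` of `C_br(a)` with `b{b} = 0`. -/
def IsAInftyStructure (k : Type*) [CommRing k] [∀ A B d, Module k (H A B d)]
    (b : RawCochain H) : Prop :=
  IsCochain k 1 b ∧ brace b [(1, b)] = 0

/-- Curved dg structures: `b_n = 0` for `n ≥ 3`. -/
def IsCdgStructure (k : Type*) [CommRing k] [∀ A B d, Module k (H A B d)]
    (b : RawCochain H) : Prop :=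
  IsAInftyStructure k b ∧ ∀ (A B : Ob) (q : HPath H A B), 3 ≤ q.length → b A B q = 0

/-- Dg structures: `b_n = 0` for `n ≥ 3` and for `n = 0`. -/
def IsDgStructure (k : Type*) [CommRing k] [∀ A B d, Module k (H A B d)]
    (b : RawCochain H) : Prop :=
  IsCdgStructure k b ∧ ∀ (A B : Ob) (q : HPath H A B), q.length = 0 → b A B q = 0

/-- The operations `D_n` on the Hochschild object determined by `b`: the Hochschild differential
`D_1(φ) = ⟨b, φ⟩ = b{φ} - (-1) ^ |φ| φ{b}` and `D_n(φ_1, …, φ_n) = b{φ_1, …, φ_n}` for `n > 1`. -/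
def opD (b : RawCochain H) : List (ℤ × RawCochain H) → RawCochain H
  | [] => 0
  | [φ] => brace b [φ] - φ.1.negOnePow • brace φ.2 [(1, b)]
  | φs => brace b φs

/-- `F` is a `B_∞`-morphism from the cochains of class `𝒞` on a quiver with
`A_[0,∞[`-structure `b` to the cochains of class `𝒞'` on a quiver with `A_[0,∞[`-structure `b'`:
a graded `k`-linear map that commutes with all braces and with all operations `D_n`.
`F p` is the component of `F` in degree `p`. -/
structure IsBInftyMorphism (k : Type*) [CommRing k] [∀ A B d, Module k (H A B d)]
    {Ob' : Type*} {H' : Ob' → Ob' → ℤ → Type*} [∀ A B d, AddCommGroup (H' A B d)]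
    [∀ A B d, Module k (H' A B d)]
    (𝒞 : ℤ → RawCochain H → Prop) (𝒞' : ℤ → RawCochain H' → Prop)
    (b : RawCochain H) (b' : RawCochain H') (F : ℤ → RawCochain H → RawCochain H') : Prop where
  map_mem : ∀ p φ, 𝒞 p φ → 𝒞' p (F p φ)
  map_add : ∀ p φ ψ, 𝒞 p φ → 𝒞 p ψ → F p (φ + ψ) = F p φ + F p ψ
  map_smul : ∀ p (c : k) φ, 𝒞 p φ → F p (c • φ) = c • F p φ
  map_brace : ∀ p φ (ψs : List (ℤ × RawCochain H)), 𝒞 p φ → (∀ ψ ∈ ψs, 𝒞 ψ.1 ψ.2) →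
    F (p + (ψs.map Prod.fst).sum) (brace φ ψs)
      = brace (F p φ) (ψs.map fun ψ => (ψ.1, F ψ.1 ψ.2))
  map_opD : ∀ φs : List (ℤ × RawCochain H), (∀ φ ∈ φs, 𝒞 φ.1 φ.2) →
    F (1 + (φs.map Prod.fst).sum) (opD b φs) = opD b' (φs.map fun φ => (φ.1, F φ.1 φ.2))

end Quiver

/-! ### Twisted objects -/

/-- Objects of `Free(a)`: formal coproducts `⊕_{i ∈ I} Σ^{m_i} A_i`. -/
structure FreeObj (Ob : Type u) where
  /-- the index set -/
  I : Type w
  /-- the objects `A_i` -/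
  obj : I → Ob
  /-- the shifts `m_i` -/
  shift : I → ℤ

section Twisted

variable {Ob : Type u} (H : Ob → Ob → ℤ → Type v) [∀ A B d, AddCommGroup (H A B d)]

/-- The degree `e` part `∏_i ⊕_j (Σ^{n_j - m_i} a(A_i, B_j))^e` of `Free(a)(M, N)`; note that
`(Σ^s a(A, B))^e = a(A, B)^{e + s}`. The matrix entry `f_{ji}` is `f i j`. -/
abbrev FreeHom (M N : FreeObj.{u, w} Ob) (e : ℤ) : Type (max v w) :=
  ∀ i : M.I, Π₀ j : N.I, H (M.obj i) (N.obj j) (e + N.shift j - M.shift i)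

/-- Objects `(M, δ_M)` of `Tw_free(a)`, with `δ_M` of degree `1`. -/
structure TwObj extends FreeObj.{u, w} Ob where
  /-- the twisting morphism -/
  δ : FreeHom H toFreeObj toFreeObj 1

variable {H}

/-- The morphisms of the full subquiver of `Tw_free(a)` on a set `T` of objects. -/
abbrev TwHom (T : Set (TwObj.{u, v, w} H)) (M N : T) (e : ℤ) : Type (max v w) :=
  FreeHom H M.1.toFreeObj N.1.toFreeObj e

variable (T : Set (TwObj.{u, v, w} H))

/-- The canonical element `δ` of degree `0` of `C_br`, that is, of degree `1` of `C`: it has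
arity zero and its component at `(M, δ_M)` is `δ_M`. -/
def deltaCochain : RawCochain (TwHom T)
  | _, _, .nil M => Pi.single (M := fun e => TwHom T M M e) 1 M.1.δ
  | _, _, .cons _ _ => 0

open Classical in
/-- The sum of `± G j (f_n)_{j k_{n-1}} … (f_1)_{k_1 i}` over all indices `k_1, …, k_{n-1}` and
`j`, for a string `(f_n, …, f_1)` of matrices and a column index `i`. Only nonzero entries
contribute. The sign is that of moving the shifts `σ^s` of the entries to the left: with
`x_l = σ (f_l)_{k_l k_{l-1}}` and `s_l = m_{k_l} - m_{k_{l-1}}` it is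
`(-1) ^ ∑_l |x_l| (s_1 + … + s_{l-1})`. -/
noncomputable def entrySum {X : Type*} [AddCommGroup X] {M N : T} (i : M.1.I) :
    HPath (TwHom T) M N → (∀ j : N.1.I, HPath H (M.1.obj i) (N.1.obj j) → X) → X
  | .nil _, G => G i (.nil _)
  | @HPath.cons _ _ _ L N d f q, G => entrySum i q fun l r =>
      (f l).sum fun j x =>
        (((d + N.1.shift j - L.1.shift l) - 1) * (L.1.shift l - M.1.shift i)).negOnePow •
          G j (.cons x r)

open Classical in
/-- The image in `C_br(Tw(a))` of a cochain `φ` of degree `p` of `C_br(a)` under the canonical map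
induced by `[⊗ a(A_{l-1}, A_l), a(A_0, A_n)] ≅ [⊗ Σ^{s_l} a(A_{l-1}, A_l), Σ^{∑ s_l} a(A_0, A_n)]`:
`φ(f_n, …, f_1)_{ji} = ∑ ± φ((f_n)_{j k_{n-1}}, …, (f_1)_{k_1 i})`, with the total sign
`(-1) ^ (p ∑ s_l + ∑_l |x_l| (s_1 + … + s_{l-1}))`. -/
noncomputable def extend (p : ℤ) (φ : RawCochain H) : RawCochain (TwHom T) :=
  fun M N q e i => entrySum T i q fun j r =>
    (p * (N.1.shift j - M.1.shift i)).negOnePow •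
      DFinsupp.single j (φ _ _ r (e + N.1.shift j - M.1.shift i))

/-- The list `δ, …, δ` of length `m`. -/
def deltas (m : ℕ) : List (ℤ × RawCochain (TwHom T)) := List.replicate m (0, deltaCochain T)

/-- The term `φ{δ^{⊗ m}}` in `C_br(Tw(a))`. -/
noncomputable def embrTerm (p : ℤ) (φ : RawCochain H) (m : ℕ) : RawCochain (TwHom T) :=
  brace (extend T p φ) (deltas T m)

variable [∀ A B d, TopologicalSpace (H A B d)]

open Classical in
/-- `embr_δ(φ) = ∑_{m ≥ 0} φ{δ^{⊗ m}}`, a pointwise series, for `φ` of degree `p`. -/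
noncomputable def embr (p : ℤ) (φ : RawCochain H) : RawCochain (TwHom T) :=
  fun _ _ q e i => ∑ᶠ j, DFinsupp.single j
    (limUnder atTop fun n => ∑ m ∈ Finset.range n, embrTerm T p φ m _ _ q e i j)

/-- Pointwise convergence of the series `∑ g_m` of cochains to `Φ`. At every string and for every
column index `i`, the columns `g_m(f_n, …, f_1)_{- i}` converge in the direct sum
`⊕_j a(A_i, B_j)`: for a series in a topological direct sum of Hausdorff groups this means that all
terms are supported in one finite set of indices `j` and that every entry converges. -/
def PointwiseHasSum (g : ℕ → RawCochain (TwHom T)) (Φ : RawCochain (TwHom T)) : Prop :=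
  ∀ (M N : T) (q : HPath (TwHom T) M N) (e : ℤ) (i : M.1.I),
    (∃ J : Finset N.1.I, ∀ m, ∀ j ∉ J, g m M N q e i j = 0) ∧
    ∀ j, Tendsto (fun n => ∑ m ∈ Finset.range n, g m M N q e i j) atTop (𝓝 (Φ M N q e i j))

/-- The full subquiver of `Tw_free(a)` on the set of objects `T` is a quiver of twisted objects:
for every continuous cochain `φ` on `a`, the series `∑ φ{δ^{⊗ m}}` converges pointwise. If `a` is
discrete this says that for all `φ`, `(f_n, …, f_1)` and `i`, the column of index `i` of
`φ{δ^{⊗ m}}(f_n, …, f_1)` vanishes for large `m`, i.e. that `T` is a quiver of locally nilpotent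
twisted objects. -/
def IsTwistedQuiver (k : Type*) [CommRing k] [∀ A B d, Module k (H A B d)] : Prop :=
  ∀ (p : ℤ) (φ : RawCochain H), IsContCochain k p φ →
    ∀ (M N : T) (q : HPath (TwHom T) M N) (e : ℤ) (i : M.1.I),
      (∃ J : Finset N.1.I, ∀ m, ∀ j ∉ J, embrTerm T p φ m M N q e i j = 0) ∧
      ∀ j, ∃ x, Tendsto (fun n => ∑ m ∈ Finset.range n, embrTerm T p φ m M N q e i j)
        atTop (𝓝 x)

end Twisted

end TwistedObjects

open TwistedObjects

namespace TwistedObjects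

/-! ### Sums over cuts and insertions, and multilinear functions on strings. -/

section Calculus

variable {Ob : Type u} {H : Ob → Ob → ℤ → Type v} {X Y : Type*} [AddCommGroup X] [AddCommGroup Y]

/-! Everything rests on the identity `embr(φ{ψ_1, …, ψ_n}) = embr(φ){embr(ψ_1), …, embr(ψ_n)}`.
Given it, `embr(μ){embr(μ)} = embr(μ{μ}) = 0`, and the compatibility with the `D_n` follows because
these are built from braces with `μ`. The explicit cdg and dg formulas hold because a cochain of
arity `a` only contributes the terms with at most `a` copies of `δ`.

For cochains of bounded arity all series are finite and the identity is combinatorial. Inserting the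
`ψ_i` and then copies of `δ` in all possible ways is the same as distributing the copies of `δ` into
the arguments of the `ψ_i` and into the remaining places of `φ`. Since `δ` has degree `0` in `C_br`
and no arguments, it contributes no signs. This is `insertExp_insertSum`, proved for an arbitrary
multilinear function in place of `φ`. It is applied to cochains on matrices, where `extend_brace`
says that the matrix formula respects braces.

For unbounded arity the two sides are summed in different orders, and nothing uniform is assumed.
The substitute is that the series converges for every continuous cochain, so that components of
different cochains may be mixed arity by arity. A gliding hump argument
(`tendsto_zero_of_selections`) then shows that `embr` is continuous for the arity filtration: if
`ρ_n` vanishes in arities below `n`, then `embr(ρ_n)` tends to zero (`tendsto_embr_zero`).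

Now truncate `φ` at arity `m` and the `ψ_i` at arity `n`, and let `W m n` be the brace of the
embedded truncations. With `m` fixed and `n → ∞` it tends to some `Z m`, by continuity of the finite
sums defining `embr` of a truncation, and `Z m` tends to the right side of the identity. By the
bounded case `W m n` is also `embr` of a brace of truncations, so by arity continuity it tends to
the left side along every sequence with both indices going to infinity fast enough. If `Z` did not
tend to the left side, a sequence chosen with `n` large depending on `m` would contradict this. -/

/-- The sum of a function of two strings over all ways to cut a string into two parts. -/
def splitSum {A B : Ob} (F : ∀ C : Ob, HPath H C B → HPath H A C → X) (q : HPath H A B) : X :=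
  (q.splits.map fun s => F s.1 s.2.1 s.2.2).sum

/-- The signed sum of a function on strings over all insertions of `ψs` into a string. -/
def insertSum (ψs : List (ℤ × RawCochain H)) {A B : Ob} (G : HPath H A B → X) (q : HPath H A B) :
    X :=
  ((insertions ψs A B q).map fun x => x.1 • G x.2).sum

theorem splitSum_nil {A : Ob} (F : ∀ C : Ob, HPath H C A → HPath H A C → X) :
    splitSum F (.nil A) = F A (.nil A) (.nil A) := by
  simp [splitSum, HPath.splits]

theorem splitSum_cons {A B C : Ob} {d : ℤ} (F : ∀ D : Ob, HPath H D C → HPath H A D → X)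
    (f : H B C d) (q : HPath H A B) :
    splitSum F (.cons f q)
      = F C (.nil C) (.cons f q) + splitSum (fun D r s => F D (.cons f r) s) q := by
  simp [splitSum, HPath.splits, Function.comp_def]

theorem splitSum_add {A B : Ob} (F F' : ∀ C : Ob, HPath H C B → HPath H A C → X)
    (q : HPath H A B) :
    splitSum (fun C r s => F C r s + F' C r s) q = splitSum F q + splitSum F' q := by
  simp [splitSum, List.sum_map_add]

theorem map_splitSum {A B : Ob} (g : X →+ Y) (F : ∀ C : Ob, HPath H C B → HPath H A C → X)
    (q : HPath H A B) : g (splitSum F q) = splitSum (fun C r s => g (F C r s)) q := by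
  simp [splitSum, map_list_sum, Function.comp_def]

theorem splitSum_smul {R : Type*} [DistribSMul R X] {A B : Ob} (c : R)
    (F : ∀ C : Ob, HPath H C B → HPath H A C → X) (q : HPath H A B) :
    splitSum (fun C r s => c • F C r s) q = c • splitSum F q :=
  (map_splitSum (DistribSMul.toAddMonoidHom X c) F q).symm

theorem splitSum_zero {A B : Ob} (q : HPath H A B) :
    splitSum (fun _ _ _ => (0 : X)) q = 0 := by
  simp [splitSum]

theorem splitSum_sum {ι : Type*} (S : Finset ι) {A B : Ob}
    (F : ι → ∀ C : Ob, HPath H C B → HPath H A C → X) (q : HPath H A B) :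
    splitSum (fun C r s => ∑ a ∈ S, F a C r s) q = ∑ a ∈ S, splitSum (F a) q := by
  classical
  induction S using Finset.induction_on with
  | empty => simp [splitSum_zero]
  | insert a S ha ih => simp [Finset.sum_insert ha, splitSum_add, ih]

theorem splitSum_congr {A B : Ob} {F F' : ∀ C : Ob, HPath H C B → HPath H A C → X}
    {q : HPath H A B}
    (h : ∀ C r s, r.sdeg + s.sdeg = q.sdeg → r.length + s.length = q.length →
      F C r s = F' C r s) : splitSum F q = splitSum F' q := by
  induction q with
  | nil => simpa [splitSum_nil] using h _ _ _ (by simp [HPath.sdeg]) (by simp [HPath.length])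
  | cons f q ih =>
    rw [splitSum_cons, splitSum_cons, h _ _ _ (by simp [HPath.sdeg]) (by simp [HPath.length])]
    congr 1
    refine ih fun C r s h1 h2 => h _ _ _ ?_ ?_
    · simp only [HPath.sdeg]; omega
    · simp only [HPath.length]; omega

@[simp]
theorem insertSum_nil {A B : Ob} (G : HPath H A B → X) (q : HPath H A B) :
    insertSum [] G q = G q := by
  simp [insertSum, insertions]

theorem map_insertSum {A B : Ob} (g : X →+ Y) (ψs : List (ℤ × RawCochain H))
    (G : HPath H A B → X) (q : HPath H A B) :
    g (insertSum ψs G q) = insertSum ψs (fun r => g (G r)) q := by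
  simp [insertSum, map_list_sum, Function.comp_def, Units.smul_def]

theorem insertSum_add {A B : Ob} (ψs : List (ℤ × RawCochain H)) (G G' : HPath H A B → X)
    (q : HPath H A B) :
    insertSum ψs (fun r => G r + G' r) q = insertSum ψs G q + insertSum ψs G' q := by
  simp [insertSum, List.sum_map_add]

theorem insertSum_zero {A B : Ob} (ψs : List (ℤ × RawCochain H)) (q : HPath H A B) :
    insertSum ψs (fun _ => (0 : X)) q = 0 := by
  simp [insertSum]

theorem insertSum_smul {R : Type*} [DistribSMul R X] [SMulCommClass ℤˣ R X] {A B : Ob}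
    (c : R) (ψs : List (ℤ × RawCochain H)) (G : HPath H A B → X) (q : HPath H A B) :
    insertSum ψs (fun r => c • G r) q = c • insertSum ψs G q := by
  simp only [insertSum, List.smul_sum, List.map_map, Function.comp_def, smul_comm c]

theorem insertSum_sum {ι : Type*} (S : Finset ι) {A B : Ob} (ψs : List (ℤ × RawCochain H))
    (G : ι → HPath H A B → X) (q : HPath H A B) :
    insertSum ψs (fun r => ∑ a ∈ S, G a r) q = ∑ a ∈ S, insertSum ψs (G a) q := by
  classical
  induction S using Finset.induction_on with
  | empty => simp [insertSum_zero]
  | insert a S ha ih => simp [Finset.sum_insert ha, insertSum_add, ih]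

/-- The part of `insertSum (ψ :: ψs) G q` in which `ψ` is applied to a left part of `q`. -/
def placeSum (ψ : ℤ × RawCochain H) (ψs : List (ℤ × RawCochain H)) {A B : Ob}
    (G : HPath H A B → X) (q : HPath H A B) : X :=
  splitSum (fun C r s => ((ψs.map Prod.fst).sum * r.sdeg).negOnePow •
    insertSum ψs (fun t => G (.cons (ψ.2 C B r (r.sdeg + ψ.1 + 1)) t)) s) q

theorem sum_placeLeft (ψ : ℤ × RawCochain H) (ψs : List (ℤ × RawCochain H)) {A B : Ob}
    (G : HPath H A B → X) (q : HPath H A B) :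
    ((placeLeft ψ (ψs.map Prod.fst).sum (insertions ψs) q).map fun x => x.1 • G x.2).sum
      = placeSum ψ ψs G q := by
  simp only [placeLeft, placeSum, splitSum, insertSum]
  induction q.splits with
  | nil => rfl
  | cons s l ih =>
    rw [List.flatMap_cons, List.map_append, List.sum_append, ih]
    simp only [List.map_map, Function.comp_def, List.smul_sum, mul_smul, List.map_cons,
      List.sum_cons]

theorem insertSum_cons_nil (ψ : ℤ × RawCochain H) (ψs : List (ℤ × RawCochain H)) {A : Ob}
    (G : HPath H A A → X) : insertSum (ψ :: ψs) G (.nil A) = placeSum ψ ψs G (.nil A) := by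
  rw [← sum_placeLeft]
  simp only [insertSum, insertions, insertFirst]

/-- Either the block of `ψ` starts at the left end of the string, or `f` stays to the left of every
block and all the cochains pass it, which costs the sign. Later inductions on strings run on this
recursion. -/
theorem insertSum_cons_cons (ψ : ℤ × RawCochain H) (ψs : List (ℤ × RawCochain H)) {A B C : Ob}
    {d : ℤ} (G : HPath H A C → X) (f : H B C d) (q : HPath H A B) :
    insertSum (ψ :: ψs) G (.cons f q) = placeSum ψ ψs G (.cons f q)
      + ((ψ.1 + (ψs.map Prod.fst).sum) * (d - 1)).negOnePow •
        insertSum (ψ :: ψs) (fun r => G (.cons f r)) q := by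
  rw [← sum_placeLeft]
  simp only [insertSum, insertions, insertFirst, List.map_append, List.sum_append, List.map_map,
    Function.comp_def, List.smul_sum, mul_smul]

theorem brace_eq_insertSum [∀ A B d, AddCommGroup (H A B d)] (φ : RawCochain H)
    (ψs : List (ℤ × RawCochain H)) {A B : Ob} (q : HPath H A B) (e : ℤ) :
    brace φ ψs A B q e = insertSum ψs (fun r => φ A B r e) q := rfl

/-- `insertSum` only depends on the cochains on strings that are not longer than the given one,
and on the function on strings of a certain degree and of bounded length. -/
theorem insertSum_congr {ψs ψs' : List (ℤ × RawCochain H)} {A B : Ob} {q : HPath H A B} {n : ℕ}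
    (hn : q.length ≤ n)
    (hψ : List.Forall₂ (fun ψ ψ' => ψ.1 = ψ'.1 ∧
      ∀ A B (r : HPath H A B) e, r.length ≤ n → ψ.2 A B r e = ψ'.2 A B r e) ψs ψs')
    {G G' : HPath H A B → X}
    (hG : ∀ r : HPath H A B, r.sdeg = q.sdeg + (ψs.map Prod.fst).sum →
      r.length ≤ q.length + ψs.length → G r = G' r) :
    insertSum ψs G q = insertSum ψs' G' q := by
  induction hψ generalizing A B with
  | nil => simpa using hG q (by simp) (by simp)
  | @cons ψ ψ' ψs ψs' h hs ih =>
    have hw : (ψs.map Prod.fst).sum = (ψs'.map Prod.fst).sum := by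
      congr 1
      exact List.forall₂_eq_eq_eq ▸ (List.forall₂_map_left_iff.2
        (List.forall₂_map_right_iff.2 (hs.imp fun _ _ h => h.1)))
    have hP : ∀ {A B : Ob} {q : HPath H A B} {G G' : HPath H A B → X}, q.length ≤ n →
        (∀ r : HPath H A B, r.sdeg = q.sdeg + ((ψ :: ψs).map Prod.fst).sum →
          r.length ≤ q.length + (ψ :: ψs).length → G r = G' r) →
        placeSum ψ ψs G q = placeSum ψ' ψs' G' q := by
      intro A B q G G' hn hG
      refine splitSum_congr fun C r s h1 h2 => ?_
      rw [hw]
      congr 1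
      refine ih (by omega) fun t h3 h4 => ?_
      rw [← h.1, ← h.2 _ _ _ _ (by omega)]
      refine hG _ ?_ ?_
      · simp only [HPath.sdeg, List.map_cons, List.sum_cons]; omega
      · simp only [HPath.length, List.length_cons]; omega
    induction q with
    | nil => rw [insertSum_cons_nil, insertSum_cons_nil, hP hn hG]
    | cons f q ihq =>
      rw [insertSum_cons_cons, insertSum_cons_cons, hP hn hG, ← h.1, ← hw]
      congr 2
      refine ihq (by simp only [HPath.length] at hn; omega) fun r h3 h4 => hG _ ?_ ?_
      · simp only [HPath.sdeg]; omega
      · simp only [HPath.length]; omega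

/-! ### Multilinear functions on strings -/

variable [∀ A B d, AddCommGroup (H A B d)] {k : Type*} [CommRing k] [∀ A B d, Module k (H A B d)]
  [Module k X] [Module k Y]

/-- `LinRel c q q' q''`: the three strings agree except for one place, where they have morphisms
`f`, `g` and `f + c • g`. -/
inductive LinRel (c : k) : ∀ {A B : Ob}, HPath H A B → HPath H A B → HPath H A B → Prop
  | head {A B C : Ob} {d : ℤ} (f g : H B C d) (q : HPath H A B) :
      LinRel c (.cons f q) (.cons g q) (.cons (f + c • g) q)
  | tail {A B C : Ob} {d : ℤ} (f : H B C d) {q q' q'' : HPath H A B} (h : LinRel c q q' q'') :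
      LinRel c (.cons f q) (.cons f q') (.cons f q'')

/-- A function on the strings from `A` to `B` that is linear in every morphism. -/
def IsMultilin (k : Type*) [CommRing k] [∀ A B d, Module k (H A B d)] [Module k X] {A B : Ob}
    (G : HPath H A B → X) : Prop :=
  ∀ (c : k) (q q' q'' : HPath H A B), LinRel c q q' q'' → G q'' = G q + c • G q'

theorem LinRel.sdeg {c : k} {A B : Ob} {q q' q'' : HPath H A B} (h : LinRel c q q' q'') :
    q.sdeg = q''.sdeg ∧ q'.sdeg = q''.sdeg := by
  induction h with
  | head => simp [HPath.sdeg]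
  | tail f h ih => simp [HPath.sdeg, ih]

theorem LinRel.comp {c : k} {A B C : Ob} {q q' q'' : HPath H A B} (h : LinRel c q q' q'')
    (r : HPath H B C) : LinRel c (r.comp q) (r.comp q') (r.comp q'') := by
  induction r with
  | nil => exact h
  | cons f r ih => exact .tail f ih

namespace IsMultilin

variable {A B C : Ob} {d : ℤ}

theorem cons {G : HPath H A C → X} (hG : IsMultilin k G) (f : H B C d) :
    IsMultilin k fun r => G (.cons f r) :=
  fun c _ _ _ h => hG c _ _ _ (h.tail f)

theorem add {G G' : HPath H A C → X} (hG : IsMultilin k G) (hG' : IsMultilin k G') :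
    IsMultilin k fun r => G r + G' r := fun c _ _ _ h => by
  simp only [hG c _ _ _ h, hG' c _ _ _ h, smul_add]; abel

theorem smul {R : Type*} [DistribSMul R X] [SMulCommClass R k X] {G : HPath H A C → X}
    (hG : IsMultilin k G) (a : R) : IsMultilin k fun r => a • G r := fun c _ _ _ h => by
  simp only [hG c _ _ _ h, smul_add, smul_comm a c]

theorem sum {ι : Type*} (S : Finset ι) {G : ι → HPath H A C → X}
    (hG : ∀ a ∈ S, IsMultilin k (G a)) : IsMultilin k fun r => ∑ a ∈ S, G a r :=
  fun c _ _ _ h => by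
    rw [Finset.smul_sum, ← Finset.sum_add_distrib]
    exact Finset.sum_congr rfl fun a ha => hG a ha c _ _ _ h

theorem map {G : HPath H A C → X} (hG : IsMultilin k G) (g : X →ₗ[k] Y) :
    IsMultilin k fun r => g (G r) := fun c _ _ _ h => by
  simp [hG c _ _ _ h]

theorem zero : IsMultilin k fun _ : HPath H A C => (0 : X) := fun c _ _ _ _ => by simp

/-- With `c = 1` and `f = g = 0` the value `x` in question satisfies `x = x + x`. -/
theorem cons_zero {G : HPath H A C → X} (hG : IsMultilin k G) (q : HPath H A B) :
    G (.cons (0 : H B C d) q) = 0 := by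
  have := hG 1 _ _ _ (.head (0 : H B C d) 0 q)
  simpa using this

/-- A multilinear function as a linear function of the leftmost morphism. -/
def consLin {G : HPath H A C → X} (hG : IsMultilin k G) (q : HPath H A B) :
    H B C d →ₗ[k] X where
  toFun x := G (.cons x q)
  map_add' x y := by simpa using hG 1 _ _ _ (.head x y q)
  map_smul' c x := by simpa [hG.cons_zero] using hG c _ _ _ (.head 0 x q)

end IsMultilin

/-- `LinRel` follows the recursion of strings at their leftmost morphism, as do all sums over cuts
and insertions; the prefixes `r` in `IsCochain` do not. -/
theorem isCochain_iff {p : ℤ} {φ : RawCochain H} : IsCochain k p φ ↔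
    (∀ (A B : Ob) (q : HPath H A B) (e : ℤ), e ≠ q.sdeg + p + 1 → φ A B q e = 0) ∧
    ∀ (A B : Ob) (e : ℤ), IsMultilin k fun q => φ A B q e := by
  constructor
  · refine fun h => ⟨h.eq_zero, fun A B e c q q' q'' hq => ?_⟩
    -- The prefix `r` is generalised so that in the inductive step the leftmost morphism `f` can be
    -- moved into it.
    suffices hs : ∀ {B} (q q' q'' : HPath H A B), LinRel c q q' q'' → ∀ {D} (r : HPath H B D),
        φ A D (r.comp q'') e = φ A D (r.comp q) e + c • φ A D (r.comp q') e from
      hs _ _ _ hq (.nil _)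
    intro B q q' q'' hq
    induction hq with
    | head f g q => intro D r; rw [h.map_add, h.map_smul]
    | @tail _ _ _ f q q' q'' h ih =>
      intro D r
      have hc (q : HPath H A _) : r.comp (.cons f q) = (r.comp (.cons f (.nil _))).comp q := by
        clear ih h
        induction r with
        | nil => rfl
        | cons g r ih => simp only [HPath.comp]; rw [ih]
      simp only [hc]
      exact ih _
  · rintro ⟨h1, h2⟩
    refine ⟨h1, fun A B C D r q d f g e => ?_, fun A B C D r q d c f e => ?_⟩
    · simpa using h2 A D e 1 _ _ _ ((LinRel.head f g q).comp r)
    · have h0 : φ A D (r.comp (.cons (0 : H B C d) q)) e = 0 := by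
        simpa using h2 A D e 1 _ _ _ ((LinRel.head (0 : H B C d) 0 q).comp r)
      simpa [h0] using h2 A D e c _ _ _ ((LinRel.head 0 f q).comp r)

theorem IsCochain.isMultilin {p : ℤ} {φ : RawCochain H} (h : IsCochain k p φ) (A B : Ob) (e : ℤ) :
    IsMultilin k fun q => φ A B q e := (isCochain_iff.1 h).2 A B e

/-- For each cut, the varied morphism lies in exactly one of the two parts. -/
theorem isMultilin_splitSum {A B : Ob} {F : ∀ C : Ob, HPath H C B → HPath H A C → X}
    (h1 : ∀ C s, IsMultilin k fun r => F C r s) (h2 : ∀ C r, IsMultilin k fun s => F C r s) :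
    IsMultilin k (splitSum F) := by
  intro c q q' q'' h
  induction h with
  | head f g q =>
    have h3 := h2 _ (.nil _) c _ _ _ (.head f g q)
    simp only at h3
    rw [splitSum_cons, splitSum_cons, splitSum_cons, h3]
    have : (fun D r s => F D (.cons (f + c • g) r) s) = fun D r s =>
        F D (.cons f r) s + c • F D (.cons g r) s := by
      funext D r s; exact h1 D s c _ _ _ (.head f g r)
    rw [this, splitSum_add, splitSum_smul, smul_add]
    abel
  | tail f h ih =>
    have h3 := h2 _ (.nil _) c _ _ _ (.tail f h)
    simp only at h3
    rw [splitSum_cons, splitSum_cons, splitSum_cons, h3,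
      ih (F := fun D r s => F D (.cons f r) s) (fun C s => (h1 C s).cons f) (fun C r => h2 C _)]
    rw [smul_add]; abel

theorem isMultilin_placeTerm {ψ : RawCochain H} {p w : ℤ}
    (hψ : ∀ A B e, IsMultilin k fun q => ψ A B q e) {ψs : List (ℤ × RawCochain H)} {A B C : Ob}
    {G : HPath H A B → X} (hG : IsMultilin k G) (s : HPath H A C) :
    IsMultilin k fun r : HPath H C B => (w * r.sdeg).negOnePow •
      insertSum ψs (fun t => G (.cons (ψ C B r (r.sdeg + p + 1)) t)) s := by
  intro c q q' q'' h
  beta_reduce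
  rw [h.sdeg.1, h.sdeg.2]
  simp only [hψ _ _ _ c _ _ _ h]
  have h' := fun t => hG c _ _ _
    (.head (ψ C B q (q''.sdeg + p + 1)) (ψ C B q' (q''.sdeg + p + 1)) t)
  simp only [h', insertSum_add, insertSum_smul, smul_add, smul_comm c]

theorem isMultilin_insertSum {ψs : List (ℤ × RawCochain H)}
    (hψ : ∀ ψ ∈ ψs, ∀ A B e, IsMultilin k fun q => ψ.2 A B q e) {A B : Ob} {G : HPath H A B → X}
    (hG : IsMultilin k G) : IsMultilin k (insertSum ψs G) := by
  induction ψs generalizing A B with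
  | nil => simpa [IsMultilin] using hG
  | cons ψ ψs ih =>
    simp only [List.mem_cons, forall_eq_or_imp] at hψ
    have hP : ∀ {A B : Ob} {G : HPath H A B → X}, IsMultilin k G →
        IsMultilin k (placeSum ψ ψs G) := fun hG =>
      isMultilin_splitSum (fun C s => isMultilin_placeTerm hψ.1 hG s)
        (fun C r => (ih hψ.2 (hG.cons _)).smul _)
    intro c q q' q'' h
    induction h with
    | head f g q =>
      simp only [insertSum_cons_cons]
      have h' := fun r => hG c _ _ _ (.head f g r)
      simp only [h', insertSum_add, insertSum_smul, hP hG c _ _ _ (.head f g q), smul_add,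
        smul_comm c]
      abel
    | tail f h ihq =>
      simp only [insertSum_cons_cons]
      rw [hP hG c _ _ _ (.tail f h), ihq (hG.cons f)]
      simp only [smul_add, smul_comm c]
      abel

theorem IsCochain.brace {p : ℤ} {φ : RawCochain H} (hφ : IsCochain k p φ)
    {ψs : List (ℤ × RawCochain H)} (hψ : ∀ ψ ∈ ψs, IsCochain k ψ.1 ψ.2) :
    IsCochain k (p + (ψs.map Prod.fst).sum) (brace φ ψs) := by
  refine isCochain_iff.2 ⟨fun A B q e he => ?_, fun A B e =>
    isMultilin_insertSum (fun ψ h => (hψ ψ h).isMultilin) (hφ.isMultilin A B e)⟩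
  rw [brace_eq_insertSum, insertSum_congr (G' := fun _ => 0) le_rfl
    (List.forall₂_same.2 fun _ _ => ⟨rfl, fun _ _ _ _ _ => rfl⟩), insertSum_zero]
  -- Insertion changes the degree of a string by the sum of the degrees inserted, so in a wrong
  -- output degree each term is a value of `φ` in a wrong degree.
  intro r h1 _
  exact hφ.eq_zero _ _ _ _ (by omega)

end Calculus

/-! ### Inserting arbitrarily many copies of an arity-zero cochain of degree zero. -/

section Exponential

variable {Ob : Type u} {H : Ob → Ob → ℤ → Type v}
  {X Y : Type*} [AddCommGroup X] [AddCommGroup Y]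

/-- The morphism of degree `1` at `A` given by an arity-zero cochain of degree `0` of `C_br`. -/
abbrev pointAt (δ : RawCochain H) (A : Ob) : H A A ((HPath.nil A : HPath H A A).sdeg + 0 + 1) :=
  δ A A (.nil A) ((HPath.nil A : HPath H A A).sdeg + 0 + 1)

/-- The sum over all insertions of `m` copies of `δ`. -/
def insertPow (δ : RawCochain H) (m : ℕ) {A B : Ob} (G : HPath H A B → X) (q : HPath H A B) : X :=
  insertSum (List.replicate m (0, δ)) G q

/-- The sum over all insertions of fewer than `L` copies of `δ`. -/
def insertExp (δ : RawCochain H) (L : ℕ) {A B : Ob} (G : HPath H A B → X) (q : HPath H A B) : X :=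
  ∑ m ∈ Finset.range L, insertPow δ m G q

/-- `G` vanishes on all strings of length at least `n`. -/
def VanishesFrom (n : ℕ) {A B : Ob} (G : HPath H A B → X) : Prop :=
  ∀ q : HPath H A B, n ≤ q.length → G q = 0

variable {δ : RawCochain H} {A B C : Ob} {d : ℤ} {L : ℕ}

theorem VanishesFrom.cons {n : ℕ} {G : HPath H A C → X} (h : VanishesFrom n G) (f : H B C d) :
    VanishesFrom (n - 1) fun r => G (.cons f r) :=
  fun q hq => h _ (by simp only [HPath.length]; omega)

theorem VanishesFrom.mono {n m : ℕ} {G : HPath H A C → X} (h : VanishesFrom n G) (hm : n ≤ m) :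
    VanishesFrom m G := fun q hq => h q (hm.trans hq)

@[simp]
theorem insertPow_zero (G : HPath H A B → X) (q : HPath H A B) : insertPow δ 0 G q = G q := by
  simp [insertPow]

theorem sum_replicate_zero_deg (m : ℕ) :
    ((List.replicate m ((0 : ℤ), δ)).map Prod.fst).sum = 0 := by
  simp

theorem insertPow_succ_nil (m : ℕ) (G : HPath H A A → X) :
    insertPow δ (m + 1) G (.nil A)
      = insertPow δ m (fun r => G (.cons (pointAt δ A) r)) (.nil A) := by
  simp only [insertPow, List.replicate_succ, insertSum_cons_nil, placeSum, splitSum_nil,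
    sum_replicate_zero_deg, zero_mul, Int.negOnePow_zero, one_smul]

theorem insertPow_zero_fun (m : ℕ) (q : HPath H A B) :
    insertPow δ m (fun _ => (0 : X)) q = 0 := insertSum_zero _ _

theorem insertExp_zero_fun (q : HPath H A B) : insertExp δ L (fun _ => (0 : X)) q = 0 := by
  simp [insertExp, insertPow_zero_fun]

theorem insertExp_add (G G' : HPath H A B → X) (q : HPath H A B) :
    insertExp δ L (fun r => G r + G' r) q = insertExp δ L G q + insertExp δ L G' q := by
  simp [insertExp, insertPow, insertSum_add, Finset.sum_add_distrib]

theorem insertExp_smul {R : Type*} [DistribSMul R X] [SMulCommClass ℤˣ R X] (c : R)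
    (G : HPath H A B → X) (q : HPath H A B) :
    insertExp δ L (fun r => c • G r) q = c • insertExp δ L G q := by
  simp [insertExp, insertPow, insertSum_smul, Finset.smul_sum]

theorem map_insertExp (g : X →+ Y) (G : HPath H A B → X) (q : HPath H A B) :
    g (insertExp δ L G q) = insertExp δ L (fun r => g (G r)) q := by
  simp [insertExp, insertPow, map_insertSum]

variable [∀ A B d, AddCommGroup (H A B d)] {k : Type*} [CommRing k] [∀ A B d, Module k (H A B d)]
  [Module k X]

/-- The leftmost copy of `δ` stands before or after `f`. A copy applied to a nonempty block gives
zero, which kills the term by multilinearity of `G`, and no sign occurs because `δ` has degree `0`.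
-/
theorem insertPow_succ_cons (hδ : HasArity 0 δ) (m : ℕ) {G : HPath H A C → X}
    (hG : IsMultilin k G) (f : H B C d) (q : HPath H A B) :
    insertPow δ (m + 1) G (.cons f q)
      = insertPow δ m (fun r => G (.cons (pointAt δ C) r)) (.cons f q)
        + insertPow δ (m + 1) (fun r => G (.cons f r)) q := by
  have h : ∀ (D : Ob) (r : HPath H D B) e, δ D C (.cons f r) e = 0 := fun D r e => by
    rw [hδ _ _ _ (by simp [HPath.length])]; rfl
  simp only [insertPow, List.replicate_succ, insertSum_cons_cons, placeSum, splitSum_cons,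
    sum_replicate_zero_deg, zero_mul, add_zero, Int.negOnePow_zero, one_smul, h, hG.cons_zero,
    insertSum_zero, splitSum_zero]

/-- Every copy of `δ` that contributes takes no argument, so the length grows by exactly `m`; for
general insertions `insertSum_congr` only has an upper bound. -/
theorem insertPow_congr (hδ : HasArity 0 δ) {m : ℕ} {G G' : HPath H A B → X}
    (hG : IsMultilin k G) (hG' : IsMultilin k G') {q : HPath H A B}
    (h : ∀ r : HPath H A B, r.sdeg = q.sdeg → r.length = q.length + m → G r = G' r) :
    insertPow δ m G q = insertPow δ m G' q := by
  induction m generalizing A B with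
  | zero => simpa using h q rfl rfl
  | succ m ihm =>
    induction q with
    | nil =>
      rw [insertPow_succ_nil, insertPow_succ_nil]
      refine ihm (hG.cons _) (hG'.cons _) fun r h1 h2 => h _ ?_ ?_
      · simp [HPath.sdeg, h1]
      · simp [HPath.length, h2]
    | cons f q ihq =>
      rw [insertPow_succ_cons hδ _ hG, insertPow_succ_cons hδ _ hG', ihm (hG.cons _) (hG'.cons _),
        ihq (hG.cons f) (hG'.cons f)]
      · intro r h1 h2
        refine h _ ?_ ?_
        · simp [HPath.sdeg, h1]
        · simp only [HPath.length, h2]; omega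
      · intro r h1 h2
        refine h _ ?_ ?_
        · simp [HPath.sdeg, h1]
        · simp only [HPath.length, h2]; omega

theorem insertPow_eq_zero (hδ : HasArity 0 δ) {m n : ℕ} {G : HPath H A B → X}
    (hG : IsMultilin k G) (h : VanishesFrom n G) {q : HPath H A B} (hm : n ≤ q.length + m) :
    insertPow δ m G q = 0 := by
  rw [insertPow_congr hδ hG IsMultilin.zero fun r _ h2 => h r (by omega), insertPow_zero_fun]

theorem insertExp_congr (hδ : HasArity 0 δ) {G G' : HPath H A B → X}
    (hG : IsMultilin k G) (hG' : IsMultilin k G') {q : HPath H A B}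
    (h : ∀ r : HPath H A B, r.sdeg = q.sdeg → G r = G' r) :
    insertExp δ L G q = insertExp δ L G' q :=
  Finset.sum_congr rfl fun _ _ => insertPow_congr hδ hG hG' fun r h1 _ => h r h1

theorem VanishesFrom.insertExp (hδ : HasArity 0 δ) {n : ℕ} {G : HPath H A B → X}
    (hG : IsMultilin k G) (h : VanishesFrom n G) : VanishesFrom n (insertExp δ L G) :=
  fun _ hq => Finset.sum_eq_zero fun _ _ => insertPow_eq_zero hδ hG h (by omega)

/-- The recursion of `insertPow_succ_cons` summed over `m`. Its second summand falls one term short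
of the cutoff `L`; the missing term vanishes because a further `δ` lies in front and `n ≤ L`. -/
theorem insertExp_cons (hδ : HasArity 0 δ) {n : ℕ} {G : HPath H A C → X}
    (hG : IsMultilin k G) (h : VanishesFrom n G) (hn : n ≤ L) (f : H B C d) (q : HPath H A B) :
    insertExp δ L G (.cons f q)
      = insertExp δ L (fun r => G (.cons f r)) q
        + insertExp δ L (fun r => G (.cons (pointAt δ C) r)) (.cons f q) := by
  cases L with
  | zero => simp [insertExp]
  | succ L =>
    simp only [insertExp]
    rw [Finset.sum_range_succ', Finset.sum_range_succ' _ L, Finset.sum_range_succ _ L,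
      insertPow_eq_zero hδ (hG.cons (pointAt δ C)) (h.cons _)
        (by simp only [HPath.length]; omega)]
    simp only [insertPow_succ_cons hδ _ hG, Finset.sum_add_distrib, insertPow_zero, add_zero]
    abel

theorem insertExp_nil (hδ : HasArity 0 δ) {n : ℕ} {G : HPath H A A → X}
    (hG : IsMultilin k G) (h : VanishesFrom n G) (hn : n ≤ L) :
    insertExp δ L G (.nil A)
      = G (.nil A) + insertExp δ L (fun r => G (.cons (pointAt δ A) r)) (.nil A) := by
  cases L with
  -- With cutoff `0` both insertion sums are empty, so `G` has to vanish on the empty string; here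
  -- `n ≤ 0` ensures it.
  | zero => rw [h _ (by omega)]; simp [insertExp]
  | succ L =>
    simp only [insertExp]
    rw [Finset.sum_range_succ', Finset.sum_range_succ _ L,
      insertPow_eq_zero hδ (hG.cons (pointAt δ A)) (h.cons _) (by omega)]
    simp only [insertPow_succ_nil, insertPow_zero, add_zero]
    abel

/-- Inserting copies of `δ` is compatible with cutting a string into two parts. -/
theorem insertExp_splitSum (hδ : HasArity 0 δ) {n : ℕ} (hn : n ≤ L)
    {F : ∀ C : Ob, HPath H C B → HPath H A C → X} (h1 : ∀ C s, IsMultilin k fun r => F C r s)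
    (h2 : ∀ C r, IsMultilin k fun s => F C r s)
    (hF : ∀ C r s, n ≤ r.length + s.length → F C r s = 0) (q : HPath H A B) :
    insertExp δ L (splitSum F) q = splitSum (fun C r s =>
      insertExp δ L (fun r' => insertExp δ L (fun s' => F C r' s') s) r) q := by
  -- Putting a `δ` in front of a string does not shorten `q`, but it lowers the bound `n` on the
  -- arity. Hence the outer induction on `n` and the inner one on `q`, with the cutoff `L` fixed.
  induction n generalizing B with
  | zero =>
    have : F = fun _ _ _ => 0 := by
      funext C r s; exact hF C r s (by omega)
    subst this
    have h0 : splitSum (fun (C : Ob) (_ : HPath H C B) (_ : HPath H A C) => (0 : X))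
        = fun _ => 0 := by
      funext q; exact splitSum_zero q
    simp only [h0, insertExp_zero_fun, splitSum_zero]
  | succ n ihn =>
    have hS : ∀ {B} {F : ∀ C : Ob, HPath H C B → HPath H A C → X}
        (hF : ∀ C r s, n + 1 ≤ r.length + s.length → F C r s = 0),
        VanishesFrom (n + 1) (splitSum F) := fun hF q hq => by
      rw [← splitSum_zero (X := X) q]
      exact splitSum_congr fun C r s _ h => hF _ _ _ (by omega)
    have hE : ∀ {B} {F : ∀ C : Ob, HPath H C B → HPath H A C → X}
        (h1 : ∀ C s, IsMultilin k fun r => F C r s) {C} (s : HPath H A C),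
        IsMultilin k fun r => insertExp δ L (fun s' => F C r s') s := by
      intro B F h1 C s c r r' r'' h
      have := fun s => h1 C s c _ _ _ h
      simp only [this, insertExp_add, insertExp_smul]
    have hV : ∀ {B} {F : ∀ C : Ob, HPath H C B → HPath H A C → X}
        (h2 : ∀ C r, IsMultilin k fun s => F C r s)
        (hF : ∀ C r s, n + 1 ≤ r.length + s.length → F C r s = 0) {C} (s : HPath H A C),
        VanishesFrom (n + 1) fun r => insertExp δ L (fun s' => F C r s') s :=
      fun h2 hF C s r hr => VanishesFrom.insertExp hδ (n := 0) (h2 C r)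
        (fun s _ => hF _ _ _ (by omega)) _ (by omega)
    induction q with
    | nil =>
      rw [insertExp_nil hδ (isMultilin_splitSum h1 h2) (hS hF) hn]
      simp only [splitSum_cons, splitSum_nil]
      rw [insertExp_add, ihn (by omega) (fun C s => (h1 C s).cons _) (fun C r => h2 C _)
        (fun C r s h => hF _ _ _ (by simp only [HPath.length]; omega)), splitSum_nil,
        insertExp_nil hδ (hE h1 _) (hV h2 hF _) hn,
        insertExp_nil hδ (h2 _ _) (fun s hs => hF _ _ _ (by simpa [HPath.length] using hs)) hn]
      abel
    | @cons B C d f q ihq =>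
      rw [insertExp_cons hδ (isMultilin_splitSum h1 h2) (hS hF) hn]
      simp only [splitSum_cons]
      rw [insertExp_add, insertExp_add,
        ihn (by omega) (fun D s => (h1 D s).cons (pointAt δ C)) (fun D r => h2 D _)
          (fun C r s h => hF _ _ _ (by simp only [HPath.length]; omega)),
        ihq (fun C s => (h1 C s).cons f) (fun C r => h2 C _)
          (fun C r s h => hF _ _ _ (by simp only [HPath.length]; omega)),
        insertExp_nil hδ (hE h1 _) (hV h2 hF _) hn,
        insertExp_cons hδ (h2 _ (.nil _))
          (fun s hs => hF _ _ _ (by simpa [HPath.length] using hs)) hn,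
        splitSum_cons]
      -- For cuts whose left part contains `f`, a copy of `δ` may or may not precede `f`; the two
      -- cases match the two induction hypotheses.
      have : splitSum (fun D r s => insertExp δ L (fun r' => insertExp δ L (fun s' => F D r' s') s)
            (.cons f r)) q = splitSum (fun D r s =>
          insertExp δ L (fun r' => insertExp δ L (fun s' => F D (.cons f r') s') s) r
            + insertExp δ L (fun r' => insertExp δ L (fun s' => F D (.cons (pointAt δ C) r') s') s)
              (.cons f r)) q :=
        splitSum_congr fun D r s _ _ => insertExp_cons hδ (hE h1 _) (hV h2 hF _) hn f r
      rw [this, splitSum_add]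
      abel

/-- A block of length at least `N` gives zero, and a shorter one is replaced by a single morphism,
so each insertion shortens the string by less than `N`. -/
theorem VanishesFrom.insertSum {n N : ℕ} {ψs : List (ℤ × RawCochain H)}
    (hψ : ∀ ψ ∈ ψs, ∀ A B e, VanishesFrom N fun q => ψ.2 A B q e)
    {G : HPath H A B → X} (hG : IsMultilin k G) (h : VanishesFrom n G) :
    VanishesFrom (n + ψs.length * N) (insertSum ψs G) := by
  induction ψs generalizing n A B with
  | nil => simpa [VanishesFrom] using h
  | cons ψ ψs ih =>
    simp only [List.mem_cons, forall_eq_or_imp] at hψ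
    have hP : ∀ {n} {A B : Ob} {G : HPath H A B → X}, IsMultilin k G → VanishesFrom n G →
        VanishesFrom (n + (ψs.length + 1) * N) (placeSum ψ ψs G) := by
      intro n A B G hG h q hq
      rw [← splitSum_zero (X := X) q]
      refine splitSum_congr fun C r s _ h1 => ?_
      by_cases hr : N ≤ r.length
      · have := fun e => hψ.1 C B e r hr
        simp only at this
        simp only [this, hG.cons_zero, insertSum_zero, smul_zero]
      · rw [ih hψ.2 (hG.cons _) (h.cons _) s, smul_zero]
        rw [add_mul, one_mul] at hq
        omega
    intro q hq
    rw [List.length_cons] at hq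
    induction q generalizing n with
    | nil => rw [insertSum_cons_nil, hP hG h _ hq]
    | cons f q ihq =>
      rw [insertSum_cons_cons, hP hG h _ hq, zero_add]
      -- For `n = 0` the bound cannot drop along with the length of the string, but then `G` is
      -- zero.
      rcases n with _ | n
      · have : (fun r => G (.cons f r)) = fun _ => 0 := by funext r; exact h _ (by omega)
        rw [this, insertSum_zero, smul_zero]
      · rw [ihq (hG.cons f) (h.cons f), smul_zero]
        simp only [HPath.length] at hq
        omega

/-- The sum over `m` of all `ψ{δ^{⊗ m}}` for a cochain `ψ` that vanishes on long strings. -/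
def expCochain (δ : RawCochain H) (L : ℕ) (ψ : RawCochain H) : RawCochain H :=
  fun A B q e => insertExp δ L (fun r => ψ A B r e) q

/-- Inserting `ψ_1, …, ψ_n` and then copies of `δ` amounts to first inserting copies of `δ` and
then the `∑ ψ_i{δ^{⊗ m}}`. -/
theorem insertExp_insertSum (hδ : HasArity 0 δ) {n N : ℕ} {ψs : List (ℤ × RawCochain H)}
    (hψk : ∀ ψ ∈ ψs, ∀ A B e, IsMultilin k fun q => ψ.2 A B q e)
    (hψ : ∀ ψ ∈ ψs, ∀ A B e, VanishesFrom N fun q => ψ.2 A B q e)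
    {G : HPath H A B → X} (hG : IsMultilin k G) (h : VanishesFrom n G)
    (hL : n + ψs.length * N ≤ L) (q : HPath H A B) :
    insertExp δ L (insertSum ψs G) q
      = insertSum (ψs.map fun ψ => (ψ.1, expCochain δ L ψ.2)) (insertExp δ L G) q := by
  induction ψs generalizing n A B with
  | nil =>
    have : insertSum [] G = G := by funext r; exact insertSum_nil G r
    rw [this]; simp
  | cons ψ ψs ih =>
    simp only [List.mem_cons, forall_eq_or_imp] at hψ hψk
    have hL' : n + (ψs.length * N + N) ≤ L := by
      rw [List.length_cons, add_mul, one_mul] at hL; exact hL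
    have hψ' := hψ
    have hψk' := hψk
    rw [← List.forall_mem_cons (p := fun ψ : ℤ × RawCochain H => ∀ A B e, VanishesFrom N fun q =>
      ψ.2 A B q e)] at hψ'
    rw [← List.forall_mem_cons (p := fun ψ : ℤ × RawCochain H => ∀ A B e, IsMultilin k fun q =>
      ψ.2 A B q e)] at hψk'
    rw [List.map_cons]
    set Ψ : ℤ × RawCochain H := (ψ.1, expCochain δ L ψ.2) with hΨ
    set Ψs := ψs.map fun ψ => (ψ.1, expCochain δ L ψ.2) with hΨs
    have hw : (Ψs.map Prod.fst).sum = (ψs.map Prod.fst).sum := by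
      simp [hΨs, Function.comp_def]
    have hIm : ∀ {A B : Ob} {G : HPath H A B → X}, IsMultilin k G →
        IsMultilin k (insertSum (ψ :: ψs) G) := fun hG => isMultilin_insertSum hψk' hG
    have hPm : ∀ {A B : Ob} {G : HPath H A B → X}, IsMultilin k G →
        IsMultilin k (placeSum ψ ψs G) := fun hG =>
      isMultilin_splitSum (fun C s => isMultilin_placeTerm hψk.1 hG s)
        (fun C r => (isMultilin_insertSum hψk.2 (hG.cons _)).smul _)
    have hFv : ∀ {n} {A B : Ob} {G : HPath H A B → X}, IsMultilin k G → VanishesFrom n G →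
        ∀ (C : Ob) (r : HPath H C B) (s : HPath H A C),
        n + (ψs.length * N + N) ≤ r.length + s.length →
        ((ψs.map Prod.fst).sum * r.sdeg).negOnePow •
          insertSum ψs (fun t => G (.cons (ψ.2 C B r (r.sdeg + ψ.1 + 1)) t)) s = 0 := by
      intro n A B G hG h C r s hq
      by_cases hr : N ≤ r.length
      · have := fun e => hψ.1 C B e r hr
        simp only at this
        simp only [this, hG.cons_zero, insertSum_zero, smul_zero]
      · rw [VanishesFrom.insertSum hψ.2 (hG.cons _) (h.cons _) s, smul_zero]
        omega
    have hPv : ∀ {n} {A B : Ob} {G : HPath H A B → X}, IsMultilin k G → VanishesFrom n G →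
        VanishesFrom (n + (ψs.length * N + N)) (placeSum ψ ψs G) := by
      intro n A B G hG h q hq
      rw [← splitSum_zero (X := X) q]
      exact splitSum_congr fun C r s _ h1 => hFv hG h C r s (by omega)
    have hIv : ∀ {n} {A B : Ob} {G : HPath H A B → X}, IsMultilin k G → VanishesFrom n G →
        VanishesFrom (n + (ψs.length * N + N)) (insertSum (ψ :: ψs) G) := by
      intro n A B G hG h
      have := VanishesFrom.insertSum hψ' hG h
      rwa [List.length_cons, add_mul, one_mul] at this
    -- the terms in which `ψ` is applied to a left part of the string
    have hP : ∀ {n} {A B : Ob} {G : HPath H A B → X}, IsMultilin k G → VanishesFrom n G →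
        n + (ψs.length * N + N) ≤ L → ∀ q : HPath H A B,
        placeSum Ψ Ψs (insertExp δ L G) q = insertExp δ L (placeSum ψ ψs G) q
          + placeSum Ψ Ψs (insertExp δ L fun r => G (.cons (pointAt δ B) r)) q := by
      intro n A B G hG h hL q
      -- Copies of `δ` distribute over the cut. Those in the left part are absorbed into the
      -- argument of `ψ`, and those in the right part are handled by the induction hypothesis for
      -- `ψs`.
      have h1 : insertExp δ L (placeSum ψ ψs G) q = splitSum (fun C r s =>
          ((ψs.map Prod.fst).sum * r.sdeg).negOnePow • insertSum Ψs
            (insertExp δ L fun t => G (.cons (Ψ.2 C B r (r.sdeg + ψ.1 + 1)) t)) s) q := by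
        refine (insertExp_splitSum hδ hL (fun C s => isMultilin_placeTerm hψk.1 hG s)
          (fun C r => (isMultilin_insertSum hψk.2 (hG.cons _)).smul _) (hFv hG h) q).trans ?_
        refine splitSum_congr fun C r s _ _ => ?_
        -- Everything to the right of `ψ`, as an additive function of the value of `ψ`; this lets
        -- the sum over copies of `δ` in the left part pass inside.
        let g : H C B (r.sdeg + ψ.1 + 1) →+ X :=
          { toFun x := insertExp δ L (insertSum ψs fun t => G (.cons x t)) s
            map_zero' := by
              simp only [hG.cons_zero]
              have : insertSum ψs (fun _ : HPath H A C => (0 : X)) = fun _ => 0 := by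
                funext t; exact insertSum_zero _ _
              rw [this, insertExp_zero_fun]
            map_add' x y := by
              rw [← insertExp_add]
              congr 1
              funext t
              rw [← insertSum_add]
              congr 1
              funext t
              exact (hG.consLin t).map_add x y }
        have hg : ∀ x, insertSum Ψs (insertExp δ L fun t => G (.cons x t)) s = g x := fun x =>
          (ih hψk.2 hψ.2 (hG.cons _) (h.cons _) (by omega) s).symm
        rw [hg]
        have hgm : IsMultilin k fun r' => g (ψ.2 C B r' (r.sdeg + ψ.1 + 1)) := by
          intro c q q' q'' hq
          have h1 := fun t => hG c _ _ _ (.head (ψ.2 C B q (r.sdeg + ψ.1 + 1))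
            (ψ.2 C B q' (r.sdeg + ψ.1 + 1)) t)
          have h2 := hψk.1 _ _ (r.sdeg + ψ.1 + 1) c _ _ _ hq
          simp only at h2
          change insertExp _ _ _ _ = insertExp _ _ _ _ + c • insertExp _ _ _ _
          rw [← insertExp_smul, ← insertExp_add, h2]
          congr 1
          funext t
          rw [← insertSum_smul, ← insertSum_add]
          congr 1
          funext t
          exact h1 t
        have hm : IsMultilin k fun r' : HPath H C B => insertExp δ L (fun s' =>
            ((ψs.map Prod.fst).sum * r'.sdeg).negOnePow •
              insertSum ψs (fun t => G (.cons (ψ.2 C B r' (r'.sdeg + ψ.1 + 1)) t)) s') s := by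
          intro c q q' q'' hq
          have := fun s => isMultilin_placeTerm (w := (ψs.map Prod.fst).sum) (p := ψ.1) (ψs := ψs)
            hψk.1 hG (C := C) s c _ _ _ hq
          simp only at this
          simp only [this, insertExp_add, insertExp_smul]
        rw [insertExp_congr hδ hm (hgm.smul ((ψs.map Prod.fst).sum * r.sdeg).negOnePow),
          insertExp_smul, ← map_insertExp]
        · rfl
        · intro r' hr'
          rw [hr', insertExp_smul]
          rfl
      rw [h1, placeSum, placeSum, hw, ← splitSum_add]
      refine splitSum_congr fun C r s _ _ => ?_
      rw [← smul_add, ← insertSum_add]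
      congr 2
      funext t
      -- Either no copy of `δ` precedes the value of `ψ`, or one is leftmost; the latter case is the
      -- second summand of the claim.
      exact insertExp_cons hδ hG h (by omega) _ t
    have hIδ : ∀ {A C : Ob} (G : HPath H A C → X),
        (fun r => insertSum (ψ :: ψs) G (.cons (pointAt δ C) r)) = fun r =>
          placeSum ψ ψs G (.cons (pointAt δ C) r)
            + insertSum (ψ :: ψs) (fun r => G (.cons (pointAt δ C) r)) r := by
      intro A C G
      funext r
      rw [insertSum_cons_cons]
      -- The morphism given by `δ` has suspended degree `0`, so the `ψ_i` pass it without a sign.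
      have : (HPath.nil C : HPath H C C).sdeg + 0 + 1 - 1 = 0 := by simp [HPath.sdeg]
      rw [this, mul_zero, Int.negOnePow_zero, one_smul]
    have hIf : ∀ {A B C : Ob} {d : ℤ} (G : HPath H A C → X) (f : H B C d),
        (fun r => insertSum (ψ :: ψs) G (.cons f r)) = fun r =>
          placeSum ψ ψs G (.cons f r) + ((ψ.1 + (ψs.map Prod.fst).sum) * (d - 1)).negOnePow •
            insertSum (ψ :: ψs) (fun r => G (.cons f r)) r := by
      intro A B C d G f
      funext r
      exact insertSum_cons_cons ψ ψs G f r
    have key : ∀ {n} {A B : Ob} {G : HPath H A B → X}, IsMultilin k G → VanishesFrom n G →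
        n + (ψs.length * N + N) ≤ L → ∀ q : HPath H A B,
        insertExp δ L (insertSum (ψ :: ψs) G) q
          = insertSum (Ψ :: Ψs) (insertExp δ L G) q := by
      clear hL hL' h hG q G A B n
      intro n
      -- As for cuts, a leading `δ` lowers the arity bound and leaves the string alone, so the bound
      -- is the outer induction variable.
      induction n with
      | zero =>
        intro A B G hG h hL q
        have : G = fun _ => 0 := by funext r; exact h r (by omega)
        subst this
        have h1 : insertSum (ψ :: ψs) (fun _ : HPath H A B => (0 : X)) = fun _ => 0 := by
          funext t; exact insertSum_zero _ _
        have h2 : insertExp δ L (fun _ : HPath H A B => (0 : X)) = fun _ => 0 := by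
          funext t; exact insertExp_zero_fun _
        rw [h1, h2, insertSum_zero]
      | succ n ihn =>
        intro A B G hG h hL q
        induction q with
        | nil =>
          have hδG := ihn (hG.cons (pointAt δ A)) (h.cons _) (by omega) (.nil A)
          rw [insertSum_cons_nil] at hδG ⊢
          rw [hP hG h hL, ← hδG, insertExp_nil hδ (hIm hG) (hIv hG h) hL,
            insertExp_nil hδ (hPm hG) (hPv hG h) hL, insertSum_cons_nil, hIδ, insertExp_add]
          abel
        | @cons B C d f q ihq =>
          have hδG := ihn (hG.cons (pointAt δ C)) (h.cons _) (by omega) (.cons f q)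
          rw [insertSum_cons_cons] at hδG ⊢
          have hf := ihq (hG.cons f) ((h.cons f).mono (by omega))
          have hE : (fun r => insertExp δ L G (.cons f r)) = fun r =>
            insertExp δ L (fun r => G (.cons f r)) r
              + insertExp δ L (fun r => G (.cons (pointAt δ C) r)) (.cons f r) := by
            funext r; exact insertExp_cons hδ hG h (by omega) f r
          rw [hE, insertSum_add, smul_add, ← hf, hP hG h hL,
            insertExp_cons hδ (hIm hG) (hIv hG h) hL, hIδ, hIf, insertExp_add, insertExp_add,
            insertExp_smul, hδG, insertExp_cons hδ (hPm hG) (hPv hG h) hL, hw]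
          abel
    exact key hG h hL' q

end Exponential

/-! ### Matrices over the quiver: the extension of cochains and its compatibility with braces. -/

section Entries

variable {Ob : Type u} {H : Ob → Ob → ℤ → Type v} [∀ A B d, AddCommGroup (H A B d)]
  {k : Type*} [CommRing k] [∀ A B d, Module k (H A B d)]
  {T : Set (TwObj.{u, v, w} H)} {X Y : Type*} [AddCommGroup X] [AddCommGroup Y]

open Classical in
/-- The effect on functions of strings of matrix entries of appending the matrix `f` on the left:
the recursion step of `entrySum`. -/
noncomputable def entryStep {L N : T} {A : Ob} {d : ℤ} (a : ℤ) (f : TwHom T L N d)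
    (G : ∀ j : N.1.I, HPath H A (N.1.obj j) → X) (l : L.1.I) (r : HPath H A (L.1.obj l)) : X :=
  (f l).sum fun j x =>
    (((d + N.1.shift j - L.1.shift l) - 1) * (L.1.shift l - a)).negOnePow • G j (.cons x r)

theorem entrySum_nil {M : T} (i : M.1.I)
    (G : ∀ j : M.1.I, HPath H (M.1.obj i) (M.1.obj j) → X) :
    entrySum T i (.nil M) G = G i (.nil _) := rfl

theorem entrySum_cons {M L N : T} {d : ℤ} (i : M.1.I) (f : TwHom T L N d)
    (q : HPath (TwHom T) M L) (G : ∀ j : N.1.I, HPath H (M.1.obj i) (N.1.obj j) → X) :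
    entrySum T i (.cons f q) G = entrySum T i q (entryStep (M.1.shift i) f G) := rfl

variable {M L N : T} {A : Ob} {d : ℤ} {i : M.1.I}

theorem entryStep_congr {a : ℤ} {f : TwHom T L N d}
    {G G' : ∀ j : N.1.I, HPath H A (N.1.obj j) → X} {l : L.1.I} {r : HPath H A (L.1.obj l)}
    (h : ∀ j (x : H (L.1.obj l) (N.1.obj j) (d + N.1.shift j - L.1.shift l)),
      G j (.cons x r) = G' j (.cons x r)) :
    entryStep a f G l r = entryStep a f G' l r := by
  simp only [entryStep, h]

theorem entrySum_congr {q : HPath (TwHom T) M N}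
    {G G' : ∀ j : N.1.I, HPath H (M.1.obj i) (N.1.obj j) → X}
    (h : ∀ j r, r.sdeg = q.sdeg + N.1.shift j - M.1.shift i → r.length = q.length →
      G j r = G' j r) : entrySum T i q G = entrySum T i q G' := by
  induction q with
  | nil => exact h _ _ (by simp [HPath.sdeg]) rfl
  | cons f q ih =>
    rw [entrySum_cons, entrySum_cons]
    refine ih fun l r h1 h2 => entryStep_congr fun j x => h _ _ ?_ ?_
    · simp only [HPath.sdeg, h1]; ring
    · simp [HPath.length, h2]

theorem entryStep_add {a : ℤ} (f : TwHom T L N d)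
    (G G' : ∀ j : N.1.I, HPath H A (N.1.obj j) → X) (l : L.1.I) (r : HPath H A (L.1.obj l)) :
    entryStep a f (fun j r => G j r + G' j r) l r
      = entryStep a f G l r + entryStep a f G' l r := by
  simp [entryStep, DFinsupp.sum_add]

theorem map_entryStep {a : ℤ} (g : X →+ Y) (f : TwHom T L N d)
    (G : ∀ j : N.1.I, HPath H A (N.1.obj j) → X) (l : L.1.I) (r : HPath H A (L.1.obj l)) :
    g (entryStep a f G l r) = entryStep a f (fun j r => g (G j r)) l r := by
  simp [entryStep, DFinsupp.sum, map_sum, Units.smul_def]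

theorem entrySum_add (q : HPath (TwHom T) M N)
    (G G' : ∀ j : N.1.I, HPath H (M.1.obj i) (N.1.obj j) → X) :
    entrySum T i q (fun j r => G j r + G' j r) = entrySum T i q G + entrySum T i q G' := by
  induction q with
  | nil => rfl
  | cons f q ih =>
    rw [entrySum_cons, entrySum_cons, entrySum_cons, ← ih]
    congr 1
    funext l r
    exact entryStep_add f G G' l r

theorem map_entrySum (g : X →+ Y) (q : HPath (TwHom T) M N)
    (G : ∀ j : N.1.I, HPath H (M.1.obj i) (N.1.obj j) → X) :
    g (entrySum T i q G) = entrySum T i q (fun j r => g (G j r)) := by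
  induction q with
  | nil => rfl
  | cons f q ih =>
    rw [entrySum_cons, entrySum_cons, ih]
    congr 1
    funext l r
    exact map_entryStep g f G l r

theorem entrySum_smul {R : Type*} [DistribSMul R X] (c : R) (q : HPath (TwHom T) M N)
    (G : ∀ j : N.1.I, HPath H (M.1.obj i) (N.1.obj j) → X) :
    entrySum T i q (fun j r => c • G j r) = c • entrySum T i q G :=
  (map_entrySum (DistribSMul.toAddMonoidHom X c) q G).symm

theorem entrySum_zero (q : HPath (TwHom T) M N) :
    entrySum T i q (fun _ _ => (0 : X)) = 0 := by
  simpa using (map_entrySum (0 : X →+ X) q (fun _ _ => (0 : X))).symm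

variable [Module k X] [Module k Y]

/-- The support over which the step sums varies with `f`, which hides its linearity in `f`;
`DFinsupp.lsum` makes it visible. -/
theorem entryStep_eq_lsum [DecidableEq N.1.I] {a : ℤ} (f : TwHom T L N d)
    {G : ∀ j : N.1.I, HPath H A (N.1.obj j) → X} (hG : ∀ j, IsMultilin k (G j)) (l : L.1.I)
    (r : HPath H A (L.1.obj l)) :
    entryStep a f G l r = DFinsupp.lsum ℕ (fun j =>
      (((d + N.1.shift j - L.1.shift l) - 1) * (L.1.shift l - a)).negOnePow •
        (hG j).consLin r) (f l) := by
  classical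
  rw [DFinsupp.lsum_apply_apply, DFinsupp.sumAddHom_apply, entryStep]
  congr!

theorem entryStep_add_smul {a : ℤ} (f g : TwHom T L N d) (c : k)
    {G : ∀ j : N.1.I, HPath H A (N.1.obj j) → X} (hG : ∀ j, IsMultilin k (G j)) (l : L.1.I)
    (r : HPath H A (L.1.obj l)) :
    entryStep a (f + c • g) G l r = entryStep a f G l r + c • entryStep a g G l r := by
  classical
  simp only [entryStep_eq_lsum _ hG]
  rw [Pi.add_apply, map_add, Pi.smul_apply, map_smul]

theorem isMultilin_entryStep {a : ℤ} (f : TwHom T L N d)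
    {G : ∀ j : N.1.I, HPath H A (N.1.obj j) → X} (hG : ∀ j, IsMultilin k (G j)) (l : L.1.I) :
    IsMultilin k (entryStep a f G l) :=
  IsMultilin.sum _ fun j _ => ((hG j).cons _).smul _

theorem isMultilin_entrySum {G : ∀ j : N.1.I, HPath H (M.1.obj i) (N.1.obj j) → X}
    (hG : ∀ j, IsMultilin k (G j)) :
    IsMultilin k fun q : HPath (TwHom T) M N => entrySum T i q G := by
  intro c q q' q'' h
  induction h with
  | head f g q =>
    simp only [entrySum_cons]
    rw [← entrySum_smul, ← entrySum_add]
    congr 1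
    funext l r
    exact entryStep_add_smul f g c hG l r
  | tail f h ih => exact ih (isMultilin_entryStep f hG)

/-- Summing over the entries is compatible with cutting a string into two parts. -/
theorem entrySum_splitSum (q : HPath (TwHom T) M N)
    (F : ∀ (j : N.1.I) (C : Ob), HPath H C (N.1.obj j) → HPath H (M.1.obj i) C → X) :
    entrySum T i q (fun j => splitSum (F j)) = splitSum (fun L r s =>
      entrySum T i s fun l s' => entrySum T l r fun j r' =>
        (r'.sdeg * (L.1.shift l - M.1.shift i)).negOnePow • F j (L.1.obj l) r' s') q := by
  induction q with
  | nil => simp [entrySum_nil, splitSum_nil, HPath.sdeg]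
  | @cons L N d f q ih =>
    -- The cut with empty left part is split off; in all others the entry of `f` belongs to the left
    -- part.
    have h : entryStep (M.1.shift i) f (fun j => splitSum (F j)) = fun l s =>
        entryStep (M.1.shift i) f (fun j => F j _ (.nil _)) l s
          + splitSum (fun C r' s' => entryStep (M.1.shift i) f (fun j r => F j C r s') l r') s := by
      funext l s
      simp only [entryStep, DFinsupp.sum]
      rw [splitSum_sum, ← Finset.sum_add_distrib]
      refine Finset.sum_congr rfl fun j _ => ?_
      rw [splitSum_cons, smul_add, splitSum_smul]
    rw [entrySum_cons, h, entrySum_add,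
      ih fun l C r' s' => entryStep (M.1.shift i) f (fun j r => F j C r s') l r', splitSum_cons]
    congr 1
    · rw [entrySum_cons]
      congr 1
      simp only [entrySum_nil, HPath.sdeg, zero_mul, Int.negOnePow_zero, one_smul]
    · refine splitSum_congr fun L' r s _ _ => entrySum_congr fun l' s' _ _ => ?_
      rw [entrySum_cons]
      refine entrySum_congr fun l r' _ _ => ?_
      simp only [entryStep, DFinsupp.sum]
      rw [Finset.smul_sum]
      refine Finset.sum_congr rfl fun j _ => ?_
      -- In the full string the sign of the new entry is measured from the column `i`, in the left
      -- part from the cut. The difference is what `r'.sdeg * (shift at the cut - shift at i)` gains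
      -- from the new entry.
      simp only [smul_smul, ← Int.negOnePow_add, HPath.sdeg]
      congr 2
      ring

theorem entrySum_apply {Z : Type*} (q : HPath (TwHom T) M N)
    (G : ∀ j : N.1.I, HPath H (M.1.obj i) (N.1.obj j) → Z → X) (z : Z) :
    entrySum T i q G z = entrySum T i q fun j r => G j r z :=
  map_entrySum (Pi.evalAddMonoidHom (fun _ : Z => X) z) q G

/-- The two sums concern different strings. Summing over insertions is additive in the summand, so
it commutes with `entrySum` taken in the group of functions of `t`. -/
theorem insertSum_entrySum_comm (ψs : List (ℤ × RawCochain H)) {B C : Ob}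
    (q : HPath (TwHom T) M N) (G : ∀ j : N.1.I, HPath H (M.1.obj i) (N.1.obj j) → HPath H B C → X)
    (s : HPath H B C) :
    insertSum ψs (fun t => entrySum T i q fun j r => G j r t) s
      = entrySum T i q fun j r => insertSum ψs (G j r) s := by
  let g : (HPath H B C → X) →+ X :=
    { toFun K := insertSum ψs K s
      map_zero' := insertSum_zero _ _
      map_add' K K' := insertSum_add _ K K' _ }
  have h : (fun t => entrySum T i q fun j r => G j r t) = entrySum T i q G := by
    funext t; exact (entrySum_apply q G t).symm
  rw [h]
  exact map_entrySum g q G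

/-- Column `l` of the matrix `extend T p ψ` is a sum of single entries, one for each string of
entries of `r`. Linearity of `G` in its leftmost morphism pulls this sum out. -/
theorem entryStep_extend {L' : T} (p : ℤ) (ψ : RawCochain H) (r : HPath (TwHom T) L' N) (e a : ℤ)
    {G : ∀ j : N.1.I, HPath H A (N.1.obj j) → X} (hG : ∀ j, IsMultilin k (G j)) (l : L'.1.I)
    (t : HPath H A (L'.1.obj l)) :
    entryStep a (extend T p ψ L' N r e) G l t = entrySum T l r fun j r' =>
      ((p * (N.1.shift j - L'.1.shift l)).negOnePow *
        ((e + N.1.shift j - L'.1.shift l - 1) * (L'.1.shift l - a)).negOnePow) •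
        G j (.cons (ψ _ _ r' (e + N.1.shift j - L'.1.shift l)) t) := by
  classical
  rw [entryStep_eq_lsum _ hG]
  set φ := DFinsupp.lsum ℕ (fun j =>
      (((e + N.1.shift j - L'.1.shift l) - 1) * (L'.1.shift l - a)).negOnePow •
        (hG j).consLin t) with hφ
  let g : (Π₀ j : N.1.I, H (L'.1.obj l) (N.1.obj j) (e + N.1.shift j - L'.1.shift l)) →+ X :=
    { toFun := φ
      map_zero' := map_zero φ
      map_add' := map_add φ }
  refine (map_entrySum g r _).trans (entrySum_congr fun j r' _ _ => ?_)
  simp only [Units.smul_def, map_zsmul, mul_smul]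
  congr 1
  refine (DFinsupp.sumAddHom_single _ _ _).trans ?_
  rfl

/-- Extending cochains to matrices is compatible with insertions. -/
theorem insertSum_extend {ψs : List (ℤ × RawCochain H)}
    (hψ : ∀ ψ ∈ ψs, ∀ A B e, IsMultilin k fun q => ψ.2 A B q e)
    {G : ∀ j : N.1.I, HPath H (M.1.obj i) (N.1.obj j) → X} (hG : ∀ j, IsMultilin k (G j))
    (q : HPath (TwHom T) M N) :
    insertSum (ψs.map fun ψ => (ψ.1, extend T ψ.1 ψ.2)) (fun r => entrySum T i r G) q
      = entrySum T i q fun j r =>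
        ((ψs.map Prod.fst).sum * (N.1.shift j - M.1.shift i)).negOnePow •
          insertSum ψs (G j) r := by
  induction ψs generalizing M N with
  | nil => simp
  | cons ψ ψs ih =>
    simp only [List.mem_cons, forall_eq_or_imp] at hψ
    rw [List.map_cons]
    set Ψ : ℤ × RawCochain (TwHom T) := (ψ.1, extend T ψ.1 ψ.2) with hΨ
    set Ψs := ψs.map fun ψ => (ψ.1, extend T ψ.1 ψ.2) with hΨs
    have hw : (Ψs.map Prod.fst).sum = (ψs.map Prod.fst).sum := by
      simp [hΨs, Function.comp_def]
    simp only [List.map_cons, List.sum_cons]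
    set w := (ψs.map Prod.fst).sum with hw'
    have hP : ∀ {M N : T} {i : M.1.I} {G : ∀ j : N.1.I, HPath H (M.1.obj i) (N.1.obj j) → X}
        (_ : ∀ j, IsMultilin k (G j)) (q : HPath (TwHom T) M N),
        placeSum Ψ Ψs (fun r => entrySum T i r G) q = entrySum T i q fun j r =>
          ((ψ.1 + w) * (N.1.shift j - M.1.shift i)).negOnePow • placeSum ψ ψs (G j) r := by
      intro M N i G hG q
      simp only [placeSum, ← splitSum_smul]
      rw [entrySum_splitSum]
      refine splitSum_congr fun L r s _ _ => ?_
      simp only [entrySum_cons]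
      rw [ih hψ.2 (fun l => isMultilin_entryStep _ hG l), ← entrySum_smul]
      refine entrySum_congr fun l s' _ _ => ?_
      have h1 : entryStep (M.1.shift i) (Ψ.2 L N r (r.sdeg + Ψ.1 + 1)) G l = fun t =>
          entrySum T l r fun j r' => ((ψ.1 * (N.1.shift j - L.1.shift l)).negOnePow *
            ((r.sdeg + ψ.1 + 1 + N.1.shift j - L.1.shift l - 1) *
              (L.1.shift l - M.1.shift i)).negOnePow) •
            G j (.cons (ψ.2 _ _ r' (r.sdeg + ψ.1 + 1 + N.1.shift j - L.1.shift l)) t) := by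
        funext t
        exact entryStep_extend ψ.1 ψ.2 r _ _ hG l t
      rw [h1, insertSum_entrySum_comm, ← entrySum_smul, ← entrySum_smul]
      refine entrySum_congr fun j r' h2 _ => ?_
      -- The shifts of the matrix entries compensate: `ψ` is evaluated in the degree that `placeSum`
      -- prescribes for the string of entries.
      have h3 : r.sdeg + ψ.1 + 1 + N.1.shift j - L.1.shift l = r'.sdeg + ψ.1 + 1 := by omega
      rw [h3, insertSum_smul, hw]
      simp only [smul_smul, ← Int.negOnePow_add]
      congr 1
      -- The exponents differ by `2 * w * (shift l - shift j)`: one `w * (shift l - shift j)` comes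
      -- from `r.sdeg` versus `r'.sdeg`, the other from measuring the total shift of `ψs` up to `l`
      -- instead of `j`.
      rw [Int.negOnePow_eq_iff, h2]
      refine ⟨w * (L.1.shift l - N.1.shift j), ?_⟩
      ring
    induction q with
    | nil =>
      rw [insertSum_cons_nil, hP hG]
      simp only [entrySum_nil, insertSum_cons_nil]
    | @cons L N d f q ihq =>
      rw [insertSum_cons_cons, hP hG]
      simp only [entrySum_cons]
      rw [ihq (fun l => isMultilin_entryStep f hG l), hw, ← entrySum_smul, ← entrySum_add]
      refine entrySum_congr fun l r _ _ => ?_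
      classical
      have h1 : entryStep (M.1.shift i) f G l = fun r => ∑ j ∈ (f l).support,
          (((d + N.1.shift j - L.1.shift l) - 1) * (L.1.shift l - M.1.shift i)).negOnePow •
            G j (.cons (f l j) r) := rfl
      rw [h1, insertSum_sum]
      simp only [entryStep, DFinsupp.sum]
      rw [Finset.smul_sum, Finset.smul_sum, ← Finset.sum_add_distrib]
      refine Finset.sum_congr rfl fun j _ => ?_
      rw [insertSum_cons_cons, insertSum_smul, smul_add, smul_add]
      congr 1
      simp only [smul_smul, ← Int.negOnePow_add]
      congr 1
      rw [Int.negOnePow_eq_iff]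
      refine ⟨(ψ.1 + w) * (L.1.shift l - N.1.shift j), ?_⟩
      simp only [hΨ]
      ring

open Classical in
/-- The contribution of a string of entries to the matrix `extend T p φ (f_n, …, f_1)`. -/
noncomputable def extendTerm (p : ℤ) (φ : RawCochain H) (i : M.1.I) (e : ℤ) (j : N.1.I)
    (r : HPath H (M.1.obj i) (N.1.obj j)) :
    Π₀ j : N.1.I, H (M.1.obj i) (N.1.obj j) (e + N.1.shift j - M.1.shift i) :=
  (p * (N.1.shift j - M.1.shift i)).negOnePow •
    DFinsupp.single j (φ _ _ r (e + N.1.shift j - M.1.shift i))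

theorem extend_apply (p : ℤ) (φ : RawCochain H) (q : HPath (TwHom T) M N) (e : ℤ) (i : M.1.I) :
    extend T p φ M N q e i = entrySum T i q (extendTerm p φ i e) := rfl

theorem isMultilin_extendTerm {p : ℤ} {φ : RawCochain H} (hφ : IsCochain k p φ) (i : M.1.I)
    (e : ℤ) (j : N.1.I) : IsMultilin k (extendTerm p φ i e j) := by
  classical
  intro c q q' q'' h
  have := hφ.isMultilin _ _ (e + N.1.shift j - M.1.shift i) c q q' q'' h
  simp only at this
  simp only [extendTerm, this, DFinsupp.single_add, smul_add, DFinsupp.single_smul, smul_comm c]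

theorem IsCochain.extend {p : ℤ} {φ : RawCochain H} (hφ : IsCochain k p φ) :
    IsCochain k p (extend T p φ) := by
  refine isCochain_iff.2 ⟨fun M N q e he => ?_, fun M N e => ?_⟩
  · funext i
    classical
    rw [extend_apply, Pi.zero_apply, ← entrySum_zero (i := i) q]
    refine entrySum_congr fun j r h1 _ => ?_
    rw [extendTerm, hφ.eq_zero _ _ _ _ (by omega), DFinsupp.single_zero, smul_zero]
  · intro c q q' q'' h
    funext i
    exact isMultilin_entrySum (isMultilin_extendTerm hφ i e) c q q' q'' h

theorem brace_apply_col (Φ : RawCochain (TwHom T)) (Ψs : List (ℤ × RawCochain (TwHom T)))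
    (q : HPath (TwHom T) M N) (e : ℤ) (i : M.1.I) :
    brace Φ Ψs M N q e i = insertSum Ψs (fun r => Φ M N r e i) q :=
  map_insertSum (Pi.evalAddMonoidHom (fun i : M.1.I =>
    Π₀ j : N.1.I, H (M.1.obj i) (N.1.obj j) (e + N.1.shift j - M.1.shift i)) i)
    Ψs (fun r => Φ M N r e) q

/-- Extending cochains to matrices is compatible with braces. -/
theorem extend_brace {p : ℤ} {φ : RawCochain H} (hφ : IsCochain k p φ)
    {ψs : List (ℤ × RawCochain H)} (hψ : ∀ ψ ∈ ψs, IsCochain k ψ.1 ψ.2) :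
    extend T (p + (ψs.map Prod.fst).sum) (brace φ ψs)
      = brace (extend T p φ) (ψs.map fun ψ => (ψ.1, extend T ψ.1 ψ.2)) := by
  classical
  funext M N q e i
  rw [brace_apply_col]
  simp only [extend_apply]
  rw [insertSum_extend (fun ψ h => (hψ ψ h).isMultilin) (isMultilin_extendTerm hφ i e)]
  refine entrySum_congr fun j r _ _ => ?_
  have h1 : extendTerm p φ i e j = fun r => (p * (N.1.shift j - M.1.shift i)).negOnePow •
    DFinsupp.single j (φ _ _ r (e + N.1.shift j - M.1.shift i)) := rfl
  rw [h1, extendTerm, brace_eq_insertSum, insertSum_smul, smul_smul, ← Int.negOnePow_add,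
    show (ψs.map Prod.fst).sum * (N.1.shift j - M.1.shift i) + p * (N.1.shift j - M.1.shift i)
      = (p + (ψs.map Prod.fst).sum) * (N.1.shift j - M.1.shift i) by ring]
  congr 1
  exact map_insertSum (DFinsupp.singleAddHom (fun j : N.1.I =>
    H (M.1.obj i) (N.1.obj j) (e + N.1.shift j - M.1.shift i)) j) ψs _ r

/-- Gives a convergent family of matrices one common finite index set, so that limits can be taken
termwise. -/
theorem entryStep_eq_sum {a : ℤ} (f : TwHom T L N d)
    {G : ∀ j : N.1.I, HPath H A (N.1.obj j) → X} (hG : ∀ j, IsMultilin k (G j)) (l : L.1.I)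
    (r : HPath H A (L.1.obj l)) {J : Finset N.1.I} (hJ : ∀ j ∉ J, f l j = 0) :
    entryStep a f G l r = ∑ j ∈ J,
      (((d + N.1.shift j - L.1.shift l) - 1) * (L.1.shift l - a)).negOnePow •
        G j (.cons (f l j) r) := by
  classical
  refine Finset.sum_subset (fun j hj => ?_) fun j _ hj => ?_
  · by_contra h
    exact (DFinsupp.mem_support_iff.1 hj) (hJ j h)
  · have : f l j = 0 := by simpa using hj
    simp only [this, (hG j).cons_zero, smul_zero]

theorem hasArity_deltaCochain : HasArity 0 (deltaCochain T) := by
  intro M N q hq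
  cases q with
  | nil => exact absurd rfl hq
  | cons f q => rfl

end Entries

/-! ### Convergence of strings and of sums over insertions. -/

section Convergence

variable {Ob : Type u} {H : Ob → Ob → ℤ → Type v} {ι : Type*}

/-- Convergence of a family of strings of constant shape, given a notion of convergence of
families of morphisms. -/
inductive PathTendsto (c : ∀ A B d, (ι → H A B d) → H A B d → Prop) :
    ∀ {A B : Ob}, (ι → HPath H A B) → HPath H A B → Prop
  | nil (A : Ob) : PathTendsto c (fun _ => .nil A) (.nil A)
  | cons {A B C : Ob} {d : ℤ} {fs : ι → H B C d} {f : H B C d} {qs : ι → HPath H A B}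
      {q : HPath H A B} (hf : c B C d fs f) (hq : PathTendsto c qs q) :
      PathTendsto c (fun n => .cons (fs n) (qs n)) (.cons f q)

variable {c c' : ∀ A B d, (ι → H A B d) → H A B d → Prop} {A B C : Ob}

theorem PathTendsto.mono (h : ∀ A B d fs f, c A B d fs f → c' A B d fs f)
    {qs : ι → HPath H A B} {q : HPath H A B} (hq : PathTendsto c qs q) :
    PathTendsto c' qs q := by
  induction hq with
  | nil => exact .nil _
  | cons hf _ ih => exact .cons (h _ _ _ _ _ hf) ih

theorem PathTendsto.const (h : ∀ A B d f, c A B d (fun _ => f) f) (q : HPath H A B) :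
    PathTendsto c (fun _ => q) q := by
  induction q with
  | nil => exact .nil _
  | cons f q ih => exact .cons (h _ _ _ f) ih

theorem PathTendsto.sdeg_eq {qs : ι → HPath H A B} {q : HPath H A B} (hq : PathTendsto c qs q)
    (n : ι) : (qs n).sdeg = q.sdeg := by
  induction hq with
  | nil => rfl
  | cons hf _ ih => simp only [HPath.sdeg, ih]

variable {X : Type*} [AddCommGroup X] [TopologicalSpace X] [IsTopologicalAddGroup X]
  {l : Filter ι}

theorem tendsto_splitSum {Fs : ι → ∀ C : Ob, HPath H C B → HPath H A C → X}
    {F : ∀ C : Ob, HPath H C B → HPath H A C → X}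
    (hF : ∀ C rs r ss s, PathTendsto c rs r → PathTendsto c ss s →
      Tendsto (fun n => Fs n C (rs n) (ss n)) l (𝓝 (F C r s)))
    {qs : ι → HPath H A B} {q : HPath H A B} (hq : PathTendsto c qs q) :
    Tendsto (fun n => splitSum (Fs n) (qs n)) l (𝓝 (splitSum F q)) := by
  induction hq with
  | nil =>
    simp only [splitSum_nil]
    exact hF _ _ _ _ _ (.nil _) (.nil _)
  | cons hf hq ih =>
    simp only [splitSum_cons]
    exact (hF _ _ _ _ _ (.nil _) (.cons hf hq)).add
      (ih fun C rs r ss s hr hs => hF _ _ _ _ _ (.cons hf hr) hs)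

theorem tendsto_units_smul {f : ι → X} {x : X} (h : Tendsto f l (𝓝 x)) (a : ℤˣ) :
    Tendsto (fun n => a • f n) l (𝓝 (a • x)) := by
  simp only [Units.smul_def]
  exact h.const_smul _

/-- Sums over insertions converge if the cochains, the function and the string converge. -/
theorem tendsto_insertSum (hc : ∀ A B d fs f, c A B d fs f → c' A B d fs f)
    {ψs : List (ℤ × (ι → RawCochain H) × RawCochain H)}
    (hψ : ∀ ψ ∈ ψs, ∀ (A B : Ob) (qs : ι → HPath H A B) q, PathTendsto c qs q → ∀ e,
      c' A B e (fun n => ψ.2.1 n A B (qs n) e) (ψ.2.2 A B q e))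
    {Gs : ι → HPath H A B → X} {G : HPath H A B → X}
    (hG : ∀ rs r, PathTendsto c' rs r → Tendsto (fun n => Gs n (rs n)) l (𝓝 (G r)))
    {qs : ι → HPath H A B} {q : HPath H A B} (hq : PathTendsto c qs q) :
    Tendsto (fun n => insertSum (ψs.map fun ψ => (ψ.1, ψ.2.1 n)) (Gs n) (qs n)) l
      (𝓝 (insertSum (ψs.map fun ψ => (ψ.1, ψ.2.2)) G q)) := by
  induction ψs generalizing A B with
  | nil => simpa using hG _ _ (hq.mono hc)
  | cons ψ ψs ih =>
    simp only [List.mem_cons, forall_eq_or_imp] at hψ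
    have hP : ∀ {A B : Ob} {Gs : ι → HPath H A B → X} {G : HPath H A B → X}
        (_ : ∀ rs r, PathTendsto c' rs r → Tendsto (fun n => Gs n (rs n)) l (𝓝 (G r)))
        {qs : ι → HPath H A B} {q : HPath H A B} (_ : PathTendsto c qs q),
        Tendsto (fun n => placeSum (ψ.1, ψ.2.1 n) (ψs.map fun ψ => (ψ.1, ψ.2.1 n)) (Gs n) (qs n)) l
          (𝓝 (placeSum (ψ.1, ψ.2.2) (ψs.map fun ψ => (ψ.1, ψ.2.2)) G q)) := by
      intro A B Gs G hG qs q hq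
      refine tendsto_splitSum (fun C rs r ss s hr hs => ?_) hq
      simp only [hr.sdeg_eq, List.map_map, Function.comp_def]
      refine tendsto_units_smul ?_ _
      -- The degree of the value of `ψ` is made independent of `n`, so that these values form a
      -- family in one fixed module.
      have : ∀ n, insertSum (ψs.map fun ψ => (ψ.1, ψ.2.1 n))
          (fun t => Gs n (.cons (ψ.2.1 n C B (rs n) ((rs n).sdeg + ψ.1 + 1)) t)) (ss n)
          = insertSum (ψs.map fun ψ => (ψ.1, ψ.2.1 n))
          (fun t => Gs n (.cons (ψ.2.1 n C B (rs n) (r.sdeg + ψ.1 + 1)) t)) (ss n) := fun n => by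
        rw [hr.sdeg_eq]
      simp only [this]
      exact ih hψ.2
        (Gs := fun n t => Gs n (.cons (ψ.2.1 n C B (rs n) (r.sdeg + ψ.1 + 1)) t))
        (G := fun t => G (.cons (ψ.2.2 C B r (r.sdeg + ψ.1 + 1)) t))
        (fun ts t ht => hG _ _ (.cons (hψ.1 _ _ _ _ hr _) ht)) hs
    simp only [List.map_cons]
    induction hq with
    | nil =>
      simp only [insertSum_cons_nil]
      exact hP hG (.nil _)
    | cons hf hq ihq =>
      simp only [insertSum_cons_cons, List.map_map, Function.comp_def]
      exact (hP hG (.cons hf hq)).add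
        (tendsto_units_smul (ihq fun ts t ht => hG _ _ (.cons (hc _ _ _ _ _ hf) ht)) _)

end Convergence

/-! ### Continuous cochains and their braces. -/

section Continuity

variable {Ob : Type u} {H : Ob → Ob → ℤ → Type v} [∀ A B d, TopologicalSpace (H A B d)]
  {ι : Type*} {l : Filter ι}

/-- Convergence of strings along a filter: all morphisms converge. -/
abbrev EntryTendsto (l : Filter ι) {A B : Ob} (qs : ι → HPath H A B) (q : HPath H A B) : Prop :=
  PathTendsto (fun _ _ _ fs f => Tendsto fs l (𝓝 f)) qs q

theorem entryTendsto_ofFn (n : ℕ) (A : Fin (n + 1) → Ob) (d : Fin n → ℤ)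
    {fs : ι → ∀ i : Fin n, H (A i.castSucc) (A i.succ) (d i)}
    {f : ∀ i : Fin n, H (A i.castSucc) (A i.succ) (d i)}
    (h : ∀ i, Tendsto (fun x => fs x i) l (𝓝 (f i))) :
    EntryTendsto l (fun x => HPath.ofFn n A d (fs x)) (HPath.ofFn n A d f) := by
  induction n with
  | zero => exact .nil _
  | succ n ih => exact .cons (h (Fin.last n)) (ih _ _ fun i => h i.castSucc)

/-- Bridges two descriptions: continuity is stated for tuples indexed by `Fin n`, while sums over
insertions and entries work with inductively built strings. -/
theorem EntryTendsto.ofFn_induction {A B : Ob} {qs : ι → HPath H A B} {q : HPath H A B}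
    (h : EntryTendsto l qs q) (P : ∀ A B : Ob, (ι → HPath H A B) → HPath H A B → Prop)
    (hP : ∀ n (A : Fin (n + 1) → Ob) (d : Fin n → ℤ)
      (fs : ι → ∀ i : Fin n, H (A i.castSucc) (A i.succ) (d i))
      (f : ∀ i : Fin n, H (A i.castSucc) (A i.succ) (d i)),
      Tendsto fs l (𝓝 f) →
      P _ _ (fun x => HPath.ofFn n A d (fs x)) (HPath.ofFn n A d f)) :
    P A B qs q := by
  induction h generalizing P with
  | nil =>
    exact hP 0 (fun _ => A) Fin.elim0 (fun _ i => i.elim0) (fun i => i.elim0)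
      (tendsto_pi_nhds.2 fun i => i.elim0)
  | @cons B C d xs x qs q hx hq ih =>
    refine ih (fun A B qs q => ∀ (C : Ob) (d : ℤ) (xs : ι → H B C d) (x : H B C d),
      Tendsto xs l (𝓝 x) → P A C (fun n => .cons (xs n) (qs n)) (.cons x q)) ?_ C d xs x hx
    intro n A d fs f hf C e xs x hx
    -- All objects, and likewise all degrees below, are taken from one extended family, so that the
    -- enlarged tuple has the required types without casts.
    obtain ⟨A', rfl, rfl⟩ : ∃ A' : Fin (n + 2) → Ob,
        (fun i : Fin (n + 1) => A' i.castSucc) = A ∧ A' (Fin.last _) = C :=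
      ⟨Fin.snoc A C, by simp, by simp⟩
    obtain ⟨d', rfl, rfl⟩ : ∃ d' : Fin (n + 1) → ℤ,
        (fun i : Fin n => d' i.castSucc) = d ∧ d' (Fin.last _) = e :=
      ⟨Fin.snoc d e, by simp, by simp⟩
    let ext (f : ∀ i : Fin n, H (A' i.castSucc.castSucc) (A' i.succ.castSucc) (d' i.castSucc))
        (x : H (A' (Fin.last n).castSucc) (A' (Fin.last (n + 1))) (d' (Fin.last n)))
        (i : Fin (n + 1)) : H (A' i.castSucc) (A' i.succ) (d' i) :=
      Fin.lastCases (motive := fun i => H (A' i.castSucc) (A' i.succ) (d' i)) x f i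
    have hl : ∀ f x, ext f x (Fin.last n) = x := fun f x => Fin.lastCases_last
    have hc : ∀ f x, (fun i : Fin n => ext f x i.castSucc) = f := fun f x => by
      funext i; exact Fin.lastCases_castSucc ..
    have ho : ∀ f x, HPath.ofFn (n + 1) A' d' (ext f x)
        = .cons x (HPath.ofFn n (fun i => A' i.castSucc) (fun i => d' i.castSucc) f) := fun f x => by
      rw [HPath.ofFn, hl, hc]
    have := hP (n + 1) A' d' (fun t => ext (fs t) (xs t)) (ext f x) ?_
    · simp only [ho] at this
      exact this
    · refine tendsto_pi_nhds.2 fun i => ?_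
      induction i using Fin.lastCases with
      | last => simpa only [hl] using hx
      | cast i =>
        have h1 := fun f x => congrFun (hc f x) i
        simp only [h1]
        exact tendsto_pi_nhds.1 hf i

theorem IsContinuous.tendsto {φ : RawCochain H} (hφ : IsContinuous φ) {A B : Ob}
    {qs : ι → HPath H A B} {q : HPath H A B} (h : EntryTendsto l qs q) (e : ℤ) :
    Tendsto (fun x => φ A B (qs x) e) l (𝓝 (φ A B q e)) :=
  h.ofFn_induction (fun A B qs q => Tendsto (fun x => φ A B (qs x) e) l (𝓝 (φ A B q e)))
    fun n A d _ f hf => ((hφ n A d e).tendsto f).comp hf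

variable [∀ A B d, AddCommGroup (H A B d)] [∀ A B d, IsTopologicalAddGroup (H A B d)]

theorem IsContinuous.brace {φ : RawCochain H} (hφ : IsContinuous φ)
    {ψs : List (ℤ × RawCochain H)} (hψ : ∀ ψ ∈ ψs, IsContinuous ψ.2) :
    IsContinuous (brace φ ψs) := by
  intro n A d e
  refine continuous_iff_continuousAt.2 fun f => ?_
  have h := tendsto_insertSum (l := 𝓝 f) (ψs := ψs.map fun ψ => (ψ.1, fun _ => ψ.2, ψ.2))
    (Gs := fun _ r => φ _ _ r e) (G := fun r => φ _ _ r e) (fun _ _ _ _ _ h => h)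
    (by
      intro ψ hm A B qs q hq e
      obtain ⟨ψ', hm', rfl⟩ := List.mem_map.1 hm
      exact (hψ ψ' hm').tendsto hq e)
    (fun rs r hr => hφ.tendsto hr e)
    (entryTendsto_ofFn n A d fun i => (continuous_apply i).tendsto f)
  simp only [List.map_map, Function.comp_def, Prod.mk.eta, List.map_id'] at h
  exact h

variable {k : Type*} [CommRing k] [∀ A B d, Module k (H A B d)]

theorem IsContCochain.brace {p : ℤ} {φ : RawCochain H} (hφ : IsContCochain k p φ)
    {ψs : List (ℤ × RawCochain H)} (hψ : ∀ ψ ∈ ψs, IsContCochain k ψ.1 ψ.2) :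
    IsContCochain k (p + (ψs.map Prod.fst).sum) (brace φ ψs) :=
  ⟨hφ.1.brace fun ψ h => (hψ ψ h).1, hφ.2.brace fun ψ h => (hψ ψ h).2⟩

end Continuity

/-! ### Column-wise convergence of matrices, and continuity of each term of the series. -/

section Columns

variable {Ob : Type u} {H : Ob → Ob → ℤ → Type v} [∀ A B d, AddCommGroup (H A B d)]
  [∀ A B d, TopologicalSpace (H A B d)]
  {T : Set (TwObj.{u, v, w} H)} {ι : Type*} {l : Filter ι}

/-- Convergence of matrices: every column converges entrywise and has its support in a fixed
finite set. -/
def ColTendsto (l : Filter ι) (M N : T) (e : ℤ) (fs : ι → TwHom T M N e) (f : TwHom T M N e) :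
    Prop :=
  ∀ i, (∃ J : Finset N.1.I, (∀ n, ∀ j ∉ J, fs n i j = 0) ∧ ∀ j ∉ J, f i j = 0) ∧
    ∀ j, Tendsto (fun n => fs n i j) l (𝓝 (f i j))

theorem colTendsto_const {M N : T} {e : ℤ} (f : TwHom T M N e) :
    ColTendsto l M N e (fun _ => f) f := by
  classical
  exact fun i => ⟨⟨(f i).support, by simp⟩, fun j => tendsto_const_nhds⟩

variable {k : Type*} [CommRing k] [∀ A B d, Module k (H A B d)]
  {X : Type*} [AddCommGroup X] [TopologicalSpace X] [IsTopologicalAddGroup X] [Module k X]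

/-- Sums over entries converge if the matrices converge. -/
theorem tendsto_entrySum {M N : T} {i : M.1.I} {Gs : ι → ∀ j, HPath H (M.1.obj i) (N.1.obj j) → X}
    {G : ∀ j, HPath H (M.1.obj i) (N.1.obj j) → X} (hGs : ∀ n j, IsMultilin k (Gs n j))
    (hGk : ∀ j, IsMultilin k (G j))
    (hG : ∀ j rs r, EntryTendsto l rs r → Tendsto (fun n => Gs n j (rs n)) l (𝓝 (G j r)))
    {qs : ι → HPath (TwHom T) M N} {q : HPath (TwHom T) M N}
    (hq : PathTendsto (ColTendsto l) qs q) :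
    Tendsto (fun n => entrySum T i (qs n) (Gs n)) l (𝓝 (entrySum T i q G)) := by
  induction hq with
  | nil => exact hG _ _ _ (.nil _)
  | @cons L N d fs f qs q hf hq ih =>
    simp only [entrySum_cons]
    refine ih (fun n => isMultilin_entryStep _ (hGs n)) (isMultilin_entryStep _ hGk) ?_
    intro j rs r hr
    obtain ⟨⟨J, h1, h2⟩, h3⟩ := hf j
    rw [entryStep_eq_sum f hGk j r h2]
    simp only [fun n => entryStep_eq_sum (a := M.1.shift i) (fs n) (hGs n) j (rs n) (h1 n)]
    exact tendsto_finsetSum _ fun j' _ => tendsto_units_smul (hG _ _ _ (.cons (h3 j') hr)) _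

variable [∀ A B d, IsTopologicalAddGroup (H A B d)]

theorem IsContCochain.tendsto_extend {p : ℤ} {φ : RawCochain H} (hφ : IsContCochain k p φ)
    {M N : T} {qs : ι → HPath (TwHom T) M N} {q : HPath (TwHom T) M N}
    (hq : PathTendsto (ColTendsto l) qs q) (e : ℤ) (i : M.1.I) (j : N.1.I) :
    Tendsto (fun n => extend T p φ M N (qs n) e i j) l (𝓝 (extend T p φ M N q e i j)) := by
  classical
  let g := DFinsupp.evalAddMonoidHom
    (β := fun j : N.1.I => H (M.1.obj i) (N.1.obj j) (e + N.1.shift j - M.1.shift i)) j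
  have h1 : ∀ q, extend T p φ M N q e i j
      = entrySum T i q fun j' r => extendTerm p φ i e j' r j := fun q => map_entrySum g q _
  have hm : ∀ j', IsMultilin k fun r : HPath H (M.1.obj i) (N.1.obj j') =>
      extendTerm p φ i e j' r j := fun j' => (isMultilin_extendTerm hφ.1 i e j').map
        (DFinsupp.lapply (R := k) (M := fun j : N.1.I =>
          H (M.1.obj i) (N.1.obj j) (e + N.1.shift j - M.1.shift i)) j)
  simp only [h1]
  refine tendsto_entrySum (fun _ => hm) hm (fun j' rs r hr => ?_) hq
  have h2 : ∀ r : HPath H (M.1.obj i) (N.1.obj j'), extendTerm p φ i e j' r j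
      = (p * (N.1.shift j' - M.1.shift i)).negOnePow •
        (DFinsupp.single j' (φ _ _ r (e + N.1.shift j' - M.1.shift i)) : Π₀ j : N.1.I,
          H (M.1.obj i) (N.1.obj j) (e + N.1.shift j - M.1.shift i)) j := fun r => by
    simp only [extendTerm, Units.smul_def, DFinsupp.coe_zsmul, Pi.smul_apply]
  simp only [h2]
  refine tendsto_units_smul ?_ _
  by_cases h : j' = j
  · subst h
    simpa only [DFinsupp.single_eq_same] using hφ.2.tendsto hr _
  · simpa only [DFinsupp.single_eq_of_ne (Ne.symm h)] using tendsto_const_nhds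

/-- The functions `φ{δ^{⊗ m}}` are continuous on matrices. -/
theorem IsContCochain.tendsto_embrTerm {p : ℤ} {φ : RawCochain H} (hφ : IsContCochain k p φ)
    (m : ℕ) {M N : T} {qs : ι → HPath (TwHom T) M N} {q : HPath (TwHom T) M N}
    (hq : PathTendsto (ColTendsto l) qs q) (e : ℤ) (i : M.1.I) (j : N.1.I) :
    Tendsto (fun n => embrTerm T p φ m M N (qs n) e i j) l (𝓝 (embrTerm T p φ m M N q e i j)) := by
  let g := DFinsupp.evalAddMonoidHom
    (β := fun j : N.1.I => H (M.1.obj i) (N.1.obj j) (e + N.1.shift j - M.1.shift i)) j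
  have h1 : ∀ q, embrTerm T p φ m M N q e i j
      = insertSum (deltas T m) (fun r => extend T p φ M N r e i j) q := fun q => by
    rw [embrTerm, brace_apply_col]
    exact map_insertSum g _ _ q
  simp only [h1]
  have := tendsto_insertSum (l := l) (c := ColTendsto (T := T) l) (c' := ColTendsto l)
    (ψs := List.replicate m (0, fun _ => deltaCochain T, deltaCochain T))
    (fun _ _ _ _ _ h => h)
    (by
      intro ψ hψ A B qs q hq e
      obtain rfl := List.eq_of_mem_replicate hψ
      -- The values of `δ` depend only on the shape of the string, so they are constant along the
      -- family.
      cases hq with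
      | nil => exact colTendsto_const _
      | cons => exact colTendsto_const _)
    (Gs := fun _ r => extend T p φ M N r e i j) (G := fun r => extend T p φ M N r e i j)
    (fun rs r hr => hφ.tendsto_extend hr e i j) hq
  simp only [List.map_replicate] at this
  exact this

end Columns

/-! ### The gliding hump argument. -/

section GlidingHump

variable {X : Type*} [AddCommGroup X] [TopologicalSpace X] [IsTopologicalAddGroup X]

/-- If all series that select their `m`-th term among the `m`-th terms of given series converge,
and the `n`-th given series starts later and later, then the sums of the given series tend to
zero. -/
theorem tendsto_zero_of_selections {g : ℕ → ℕ → X} {c : ℕ} {y : ℕ → X}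
    (hg : ∀ n m, c + m < n → g n m = 0)
    (hy : ∀ n, Tendsto (fun K => ∑ m ∈ Finset.range K, g n m) atTop (𝓝 (y n)))
    (hs : ∀ s : ℕ → ℕ, ∃ x, Tendsto (fun K => ∑ m ∈ Finset.range K, g (s m) m) atTop (𝓝 x)) :
    Tendsto y atTop (𝓝 0) := by
  by_contra hcon
  obtain ⟨W, ⟨hW, hWc⟩, hfr⟩ : ∃ W : Set X, (W ∈ 𝓝 0 ∧ IsClosed W) ∧ ∃ᶠ n in atTop, y n ∉ W := by
    by_contra! h
    refine hcon ((closed_nhds_basis (0 : X)).tendsto_right_iff.2 fun W hW => ?_)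
    simpa [Filter.not_frequently] using h W hW
  -- Since `W` is closed, late partial sums of a series whose sum avoids `W` avoid `W` too. The
  -- condition `c + K₀ ≤ n` makes the first `K₀` terms of that series vanish.
  have hstep : ∀ K₀ : ℕ, ∃ n K, c + K₀ ≤ n ∧ K₀ < K ∧ ∑ m ∈ Finset.range K, g n m ∉ W := by
    intro K₀
    obtain ⟨n, hn, hyn⟩ := (frequently_atTop.1 hfr) (c + K₀)
    obtain ⟨K, hK, hK'⟩ := (((hy n).eventually (hWc.isOpen_compl.mem_nhds hyn)).and
      (eventually_gt_atTop K₀)).exists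
    exact ⟨n, K, hn, hK', hK⟩
  choose n K h1 h2 h3 using hstep
  let κ : ℕ → ℕ := fun i => K^[i] 0
  have hκ : ∀ i, κ (i + 1) = K (κ i) := fun i => Function.iterate_succ_apply' K i 0
  have hmono : StrictMono κ := strictMono_nat_of_lt_succ fun i => by rw [hκ]; exact h2 _
  -- On the block `κ i ≤ m < κ (i + 1)` the selection follows the series found in step `i`.
  -- Searching up to `m` is enough because `i ≤ κ i`.
  let s : ℕ → ℕ := fun m => n (κ (Nat.findGreatest (fun i => κ i ≤ m) m))
  have hsel : ∀ i m, κ i ≤ m → m < κ (i + 1) → s m = n (κ i) := by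
    intro i m hi hm
    have : Nat.findGreatest (fun i => κ i ≤ m) m = i := by
      refine le_antisymm ?_ (Nat.le_findGreatest ((hmono.id_le i).trans hi) hi)
      have : κ (Nat.findGreatest (fun i => κ i ≤ m) m) ≤ m :=
        Nat.findGreatest_spec (P := fun i => κ i ≤ m) (Nat.zero_le m) (Nat.zero_le m)
      exact Nat.lt_succ_iff.1 (hmono.lt_iff_lt.1 (this.trans_lt hm))
    simp only [s, this]
  obtain ⟨x, hx⟩ := hs s
  have hκt : Tendsto κ atTop atTop := hmono.tendsto_atTop
  -- The block sums of a convergent series tend to zero, whereas by construction none of them lies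
  -- in `W`.
  have hd := (hx.comp (hκt.comp (tendsto_add_atTop_nat 1))).sub (hx.comp hκt)
  rw [sub_self] at hd
  obtain ⟨i, hi⟩ := (hd.eventually hW).exists
  refine h3 (κ i) ?_
  rw [← hκ]
  have h0 : ∑ m ∈ Finset.range (κ i), g (n (κ i)) m = 0 := Finset.sum_eq_zero fun m hm =>
    hg _ _ (lt_of_lt_of_le (by have := Finset.mem_range.1 hm; omega) (h1 (κ i)))
  have heq : ∑ m ∈ Finset.range (κ (i + 1)), g (n (κ i)) m
      = ∑ m ∈ Finset.range (κ (i + 1)), g (s m) m - ∑ m ∈ Finset.range (κ i), g (s m) m := by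
    rw [← Finset.sum_range_add_sum_Ico (fun m => g (n (κ i)) m) (hmono (Nat.lt_succ_self i)).le,
      ← Finset.sum_range_add_sum_Ico (fun m => g (s m) m) (hmono (Nat.lt_succ_self i)).le,
      add_sub_cancel_left, h0, zero_add]
    refine Finset.sum_congr rfl fun m hm => ?_
    rw [hsel i m (Finset.mem_Ico.1 hm).1 (Finset.mem_Ico.1 hm).2]
  rw [heq]
  exact hi

end GlidingHump

/-! ### Assembling and truncating cochains by arity. -/

section ByArity

variable {Ob : Type u} {H : Ob → Ob → ℤ → Type v}

theorem HPath.length_ofFn (n : ℕ) (A : Fin (n + 1) → Ob) (d : Fin n → ℤ)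
    (f : ∀ i : Fin n, H (A i.castSucc) (A i.succ) (d i)) : (HPath.ofFn n A d f).length = n := by
  induction n with
  | zero => rfl
  | succ n ih => exact congrArg (· + 1) (ih _ _ _)

/-- The cochain whose component of arity `n` is that of `ρ n`. -/
def byArity (ρ : ℕ → RawCochain H) : RawCochain H := fun A B q => ρ q.length A B q

variable [∀ A B d, AddCommGroup (H A B d)] {k : Type*} [CommRing k] [∀ A B d, Module k (H A B d)]

/-- The cochain with the components of `φ` of arity less than `N`. -/
def truncate (N : ℕ) (φ : RawCochain H) : RawCochain H := byArity fun n => if n < N then φ else 0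

theorem truncate_of_lt {N : ℕ} {φ : RawCochain H} {A B : Ob} {q : HPath H A B}
    (h : q.length < N) : truncate N φ A B q = φ A B q := by
  simp [truncate, byArity, h]

theorem truncate_of_le {N : ℕ} {φ : RawCochain H} {A B : Ob} {q : HPath H A B}
    (h : N ≤ q.length) : truncate N φ A B q = 0 := by
  simp [truncate, byArity, h.not_gt]

theorem LinRel.length {c : k} {A B : Ob} {q q' q'' : HPath H A B} (h : LinRel c q q' q'') :
    q.length = q''.length ∧ q'.length = q''.length := by
  induction h with
  | head => simp [HPath.length]
  | tail f h ih => simp [HPath.length, ih]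

theorem IsCochain.byArity {p : ℤ} {ρ : ℕ → RawCochain H} (h : ∀ n, IsCochain k p (ρ n)) :
    IsCochain k p (byArity ρ) := by
  refine isCochain_iff.2 ⟨fun A B q e he => (h _).eq_zero _ _ _ _ he, fun A B e c q q' q'' hq => ?_⟩
  simp only [TwistedObjects.byArity, hq.length.1, hq.length.2]
  exact (h _).isMultilin A B e c q q' q'' hq

theorem IsCochain.zero (p : ℤ) : IsCochain k p (0 : RawCochain H) :=
  isCochain_iff.2 ⟨fun _ _ _ _ _ => rfl, fun _ _ _ => IsMultilin.zero⟩

theorem IsCochain.add {p : ℤ} {φ ψ : RawCochain H} (hφ : IsCochain k p φ) (hψ : IsCochain k p ψ) :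
    IsCochain k p (φ + ψ) :=
  isCochain_iff.2 ⟨fun A B q e he => by
    simp only [Pi.add_apply, hφ.eq_zero _ _ _ _ he, hψ.eq_zero _ _ _ _ he, add_zero],
    fun A B e => (hφ.isMultilin A B e).add (hψ.isMultilin A B e)⟩

theorem IsCochain.smul {p : ℤ} {φ : RawCochain H} (hφ : IsCochain k p φ) (c : k) :
    IsCochain k p (c • φ) :=
  isCochain_iff.2 ⟨fun A B q e he => by
    simp only [Pi.smul_apply, hφ.eq_zero _ _ _ _ he, smul_zero],
    fun A B e => (hφ.isMultilin A B e).smul c⟩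

variable [∀ A B d, TopologicalSpace (H A B d)]

/-- Being a continuous cochain is a condition on each arity separately. This freedom to mix cochains
is what supplies the selections of the gliding hump argument. -/
theorem IsContCochain.byArity {p : ℤ} {ρ : ℕ → RawCochain H} (h : ∀ n, IsContCochain k p (ρ n)) :
    IsContCochain k p (byArity ρ) := by
  refine ⟨IsCochain.byArity fun n => (h n).1, fun n A d e => ?_⟩
  simp only [TwistedObjects.byArity, HPath.length_ofFn]
  exact (h n).2 n A d e

theorem IsContCochain.zero (p : ℤ) : IsContCochain k p (0 : RawCochain H) :=
  ⟨IsCochain.zero p, fun _ _ _ _ => continuous_const⟩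

theorem IsContCochain.truncate {p : ℤ} {φ : RawCochain H} (h : IsContCochain k p φ) (N : ℕ) :
    IsContCochain k p (truncate N φ) :=
  IsContCochain.byArity fun n => by
    split_ifs
    · exact h
    · exact .zero p

theorem IsContCochain.smul [∀ A B d, ContinuousConstSMul k (H A B d)] {p : ℤ} {φ : RawCochain H}
    (hφ : IsContCochain k p φ) (c : k) : IsContCochain k p (c • φ) :=
  ⟨hφ.1.smul c, fun n A d e => (hφ.2 n A d e).const_smul c⟩

variable [∀ A B d, IsTopologicalAddGroup (H A B d)]

theorem IsContCochain.add {p : ℤ} {φ ψ : RawCochain H} (hφ : IsContCochain k p φ)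
    (hψ : IsContCochain k p ψ) : IsContCochain k p (φ + ψ) :=
  ⟨hφ.1.add hψ.1, fun n A d e => (hφ.2 n A d e).add (hψ.2 n A d e)⟩

theorem IsContCochain.neg {p : ℤ} {φ : RawCochain H} (hφ : IsContCochain k p φ) :
    IsContCochain k p (-φ) :=
  ⟨by simpa using hφ.1.smul (-1), fun n A d e => (hφ.2 n A d e).neg⟩

theorem IsContCochain.sub {p : ℤ} {φ ψ : RawCochain H} (hφ : IsContCochain k p φ)
    (hψ : IsContCochain k p ψ) : IsContCochain k p (φ - ψ) := by
  rw [sub_eq_add_neg]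
  exact hφ.add hψ.neg

end ByArity

/-! ### The map `embr`: convergence, continuity in the arity, and braces. -/

section Embr

variable {Ob : Type u} {H : Ob → Ob → ℤ → Type v} [∀ A B d, AddCommGroup (H A B d)]
  {k : Type*} [CommRing k] [∀ A B d, Module k (H A B d)] {T : Set (TwObj.{u, v, w} H)}

theorem isCochain_deltaCochain : IsCochain k 0 (deltaCochain T) := by
  refine isCochain_iff.2 ⟨fun M N q e he => ?_, fun M N e c q q' q'' h => ?_⟩
  · cases q with
    | nil => exact Pi.single_eq_of_ne (by simpa [HPath.sdeg] using he) _
    | cons f q => rfl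
  · cases h with
    | head => simp [deltaCochain]
    | tail => simp [deltaCochain]

theorem embrTerm_eq_insertPow (p : ℤ) (φ : RawCochain H) (m : ℕ) {M N : T}
    (q : HPath (TwHom T) M N) (e : ℤ) : embrTerm T p φ m M N q e
      = insertPow (deltaCochain T) m (fun r => extend T p φ M N r e) q := rfl

theorem embrTerm_zero (p : ℤ) (φ : RawCochain H) : embrTerm T p φ 0 = extend T p φ := by
  funext M N q e
  rw [embrTerm_eq_insertPow, insertPow_zero]

theorem IsCochain.embrTerm {p : ℤ} {φ : RawCochain H} (hφ : IsCochain k p φ) (m : ℕ) :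
    IsCochain k p (embrTerm T p φ m) := by
  have := (IsCochain.extend (T := T) hφ).brace (ψs := deltas T m) (by
    intro ψ hψ
    obtain rfl := List.eq_of_mem_replicate hψ
    exact isCochain_deltaCochain)
  rwa [deltas, sum_replicate_zero_deg, add_zero] at this

theorem extend_congr {p : ℤ} {φ ψ : RawCochain H} {M N : T} {q : HPath (TwHom T) M N}
    (h : ∀ A B (r : HPath H A B), r.length = q.length → φ A B r = ψ A B r) (e : ℤ) :
    extend T p φ M N q e = extend T p ψ M N q e := by
  funext i
  refine entrySum_congr fun j r _ h2 => ?_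
  rw [h _ _ r h2]

theorem embrTerm_congr {p : ℤ} {φ ψ : RawCochain H} (hφ : IsCochain k p φ) (hψ : IsCochain k p ψ)
    {m : ℕ} {M N : T} {q : HPath (TwHom T) M N}
    (h : ∀ A B (r : HPath H A B), r.length = q.length + m → φ A B r = ψ A B r) (e : ℤ) :
    embrTerm T p φ m M N q e = embrTerm T p ψ m M N q e :=
  insertPow_congr hasArity_deltaCochain (hφ.extend.isMultilin M N e) (hψ.extend.isMultilin M N e)
    fun _ _ h2 => extend_congr (fun A B s hs => h A B s (hs.trans h2)) e

theorem extend_zero (p : ℤ) : extend T p (0 : RawCochain H) = 0 := by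
  classical
  funext M N q e i
  refine Eq.trans (entrySum_congr fun j r _ _ => ?_) (entrySum_zero q)
  rw [Pi.zero_apply, Pi.zero_apply, Pi.zero_apply, Pi.zero_apply, DFinsupp.single_zero, smul_zero]

theorem extend_add (p : ℤ) (φ ψ : RawCochain H) :
    extend T p (φ + ψ) = extend T p φ + extend T p ψ := by
  classical
  funext M N q e i
  refine Eq.trans (entrySum_congr fun j r _ _ => ?_) (entrySum_add q _ _)
  simp only [Pi.add_apply, DFinsupp.single_add, smul_add]

theorem extend_smul (p : ℤ) (c : k) (φ : RawCochain H) :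
    extend T p (c • φ) = c • extend T p φ := by
  classical
  funext M N q e i
  refine Eq.trans (entrySum_congr fun j r _ _ => ?_) (entrySum_smul c q _)
  simp only [Pi.smul_apply, DFinsupp.single_smul, smul_comm c]

theorem embrTerm_zero_cochain (p : ℤ) (m : ℕ) : embrTerm T p (0 : RawCochain H) m = 0 := by
  funext M N q e
  rw [embrTerm_eq_insertPow, extend_zero]
  exact insertPow_zero_fun _ _

theorem embrTerm_add (p : ℤ) (φ ψ : RawCochain H) (m : ℕ) :
    embrTerm T p (φ + ψ) m = embrTerm T p φ m + embrTerm T p ψ m := by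
  funext M N q e
  simp only [Pi.add_apply, embrTerm_eq_insertPow, extend_add]
  exact insertSum_add _ _ _ _

theorem embrTerm_smul (p : ℤ) (c : k) (φ : RawCochain H) (m : ℕ) :
    embrTerm T p (c • φ) m = c • embrTerm T p φ m := by
  funext M N q e
  simp only [Pi.smul_apply, embrTerm_eq_insertPow, extend_smul (k := k)]
  exact insertSum_smul c _ _ _

theorem brace_apply_entry (Φ : RawCochain (TwHom T)) (Ψs : List (ℤ × RawCochain (TwHom T)))
    {M N : T} (q : HPath (TwHom T) M N) (e : ℤ) (i : M.1.I) (j : N.1.I) :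
    brace Φ Ψs M N q e i j = insertSum Ψs (fun r => Φ M N r e i j) q := by
  rw [brace_apply_col]
  exact map_insertSum (DFinsupp.evalAddMonoidHom
    (β := fun j : N.1.I => H (M.1.obj i) (N.1.obj j) (e + N.1.shift j - M.1.shift i)) j) _ _ q

variable [∀ A B d, TopologicalSpace (H A B d)] [∀ A B d, T2Space (H A B d)] {p : ℤ}
  {φ ψ : RawCochain H}

/-- The series that defines `embr_δ` converges. -/
theorem IsTwistedQuiver.pointwiseHasSum (hT : IsTwistedQuiver T k) (hφ : IsContCochain k p φ) :
    PointwiseHasSum T (embrTerm T p φ) (embr T p φ) := by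
  classical
  intro M N q e i
  obtain ⟨⟨J, hJ⟩, h⟩ := hT p φ hφ M N q e i
  refine ⟨⟨J, hJ⟩, fun j => ?_⟩
  obtain ⟨x, hx⟩ := h j
  suffices hs : embr T p φ M N q e i j
      = limUnder atTop fun n => ∑ m ∈ Finset.range n, embrTerm T p φ m M N q e i j by
    rw [hs, hx.limUnder_eq]
    exact hx
  -- Off `J` all partial sums are zero and limits are unique, so the `finsum` defining `embr` really
  -- has finite support.
  have h0 : ∀ j ∉ J,
      (limUnder atTop fun n => ∑ m ∈ Finset.range n, embrTerm T p φ m M N q e i j) = 0 := by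
    intro j hj
    simp only [fun m => hJ m j hj, Finset.sum_const_zero]
    exact tendsto_const_nhds.limUnder_eq
  rw [embr, finsum_eq_sum_of_support_subset (s := J)]
  · rw [DFinsupp.finsetSum_apply]
    by_cases hj : j ∈ J
    · rw [Finset.sum_eq_single_of_mem j hj]
      · convert DFinsupp.single_eq_same
      · intro j' _ hne
        convert DFinsupp.single_eq_of_ne hne.symm
    · rw [h0 j hj]
      refine Finset.sum_eq_zero fun j' hj' => ?_
      convert DFinsupp.single_eq_of_ne (b := _) (fun h : j = j' => hj (h ▸ hj'))
  · intro j hj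
    by_contra hjJ
    refine hj ?_
    simp only [h0 j hjJ]
    convert DFinsupp.single_zero j

theorem IsTwistedQuiver.tendsto_embr (hT : IsTwistedQuiver T k) (hφ : IsContCochain k p φ) {M N : T}
    (q : HPath (TwHom T) M N) (e : ℤ) (i : M.1.I) (j : N.1.I) :
    Tendsto (fun n => ∑ m ∈ Finset.range n, embrTerm T p φ m M N q e i j) atTop
      (𝓝 (embr T p φ M N q e i j)) :=
  (hT.pointwiseHasSum hφ M N q e i).2 j

/-- If almost all terms of the series vanish, its sum is a finite sum. -/
theorem IsTwistedQuiver.embr_eq_sum (hT : IsTwistedQuiver T k) (hφ : IsContCochain k p φ) {M N : T}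
    (q : HPath (TwHom T) M N) (e : ℤ) {L : ℕ} (h : ∀ m, L ≤ m → embrTerm T p φ m M N q e = 0) :
    embr T p φ M N q e = ∑ m ∈ Finset.range L, embrTerm T p φ m M N q e := by
  funext i
  ext j
  refine tendsto_nhds_unique (hT.tendsto_embr hφ q e i j) (tendsto_const_nhds.congr' ?_)
  filter_upwards [eventually_ge_atTop L] with n hn
  rw [Finset.sum_apply, DFinsupp.finsetSum_apply]
  refine Finset.sum_subset (Finset.range_subset_range.2 hn) fun m _ hm => ?_
  rw [h m (by simpa using hm)]
  rfl

/-- The term with `m` copies of `δ` only involves `φ` in arity `q.length + m`. -/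
theorem IsTwistedQuiver.embr_eq_sum_of_vanishes (hT : IsTwistedQuiver T k) (hφ : IsContCochain k p φ) {n : ℕ}
    (hn : ∀ A B (r : HPath H A B), n ≤ r.length → φ A B r = 0) {M N : T}
    (q : HPath (TwHom T) M N) (e : ℤ) {L : ℕ} (hL : n ≤ q.length + L) :
    embr T p φ M N q e = ∑ m ∈ Finset.range L, embrTerm T p φ m M N q e := by
  refine hT.embr_eq_sum hφ q e fun m hm => ?_
  rw [embrTerm_congr hφ.1 (IsCochain.zero p) (fun A B r hr => hn A B r (by omega)),
    embrTerm_zero_cochain]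
  rfl

/-- Truncating the arity of `φ` amounts to truncating the series at a place depending on the string.
-/
theorem IsTwistedQuiver.embr_truncate (hT : IsTwistedQuiver T k) (hφ : IsContCochain k p φ) (n : ℕ) {M N : T}
    (q : HPath (TwHom T) M N) (e : ℤ) :
    embr T p (truncate n φ) M N q e
      = ∑ m ∈ Finset.range (n - q.length), embrTerm T p φ m M N q e := by
  rw [hT.embr_eq_sum_of_vanishes (hφ.truncate n) (fun A B r => truncate_of_le)
    (L := n - q.length) q e (by omega)]
  refine Finset.sum_congr rfl fun m hm => ?_
  rw [Finset.mem_range] at hm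
  exact embrTerm_congr (hφ.truncate n).1 hφ.1 (fun A B r hr => truncate_of_lt (by omega)) e

/-- On a fixed string these matrices are the partial sums of the defining series, with index shifted
by the length of the string. -/
theorem IsTwistedQuiver.colTendsto_embr_truncate (hT : IsTwistedQuiver T k) (hφ : IsContCochain k p φ) {M N : T}
    (q : HPath (TwHom T) M N) (e : ℤ) :
    ColTendsto atTop M N e (fun n => embr T p (truncate n φ) M N q e) (embr T p φ M N q e) := by
  intro i
  obtain ⟨⟨J, hJ⟩, h⟩ := hT.pointwiseHasSum hφ M N q e i
  have h1 : ∀ n j, embr T p (truncate n φ) M N q e i j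
      = ∑ m ∈ Finset.range (n - q.length), embrTerm T p φ m M N q e i j := fun n j => by
    rw [hT.embr_truncate hφ, Finset.sum_apply, DFinsupp.finsetSum_apply]
  refine ⟨⟨J, fun n j hj => ?_, fun j hj => ?_⟩, fun j => ?_⟩
  · rw [h1]
    exact Finset.sum_eq_zero fun m _ => hJ m j hj
  · refine tendsto_nhds_unique (h j) ?_
    simp only [fun m => hJ m j hj, Finset.sum_const_zero]
    exact tendsto_const_nhds
  · simp only [h1]
    exact (h j).comp (tendsto_sub_atTop_nat _)

/-- `embr_δ` is continuous with respect to the filtration by arity. -/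
theorem IsTwistedQuiver.tendsto_embr_zero (hT : IsTwistedQuiver T k) [∀ A B d, IsTopologicalAddGroup (H A B d)]
    {ρ : ℕ → RawCochain H} (hρ : ∀ n, IsContCochain k p (ρ n))
    (h0 : ∀ n A B (r : HPath H A B), r.length < n → ρ n A B r = 0) {M N : T}
    (q : HPath (TwHom T) M N) (e : ℤ) (i : M.1.I) (j : N.1.I) :
    Tendsto (fun n => embr T p (ρ n) M N q e i j) atTop (𝓝 0) := by
  refine tendsto_zero_of_selections (c := q.length)
    (g := fun n m => embrTerm T p (ρ n) m M N q e i j) (fun n m hm => ?_)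
    (fun n => hT.tendsto_embr (hρ n) q e i j) fun s => ?_
  · rw [embrTerm_congr (hρ n).1 (IsCochain.zero p) (fun A B r hr => h0 n A B r (by omega)),
      embrTerm_zero_cochain]
    rfl
  · have hθ : IsContCochain k p (byArity fun a => ρ (s (a - q.length))) := .byArity fun n => hρ _
    refine ⟨_, (hT.tendsto_embr hθ q e i j).congr fun K => Finset.sum_congr rfl fun m _ => ?_⟩
    rw [embrTerm_congr hθ.1 (hρ (s m)).1 (fun A B r hr => ?_)]
    simp only [byArity, hr, Nat.add_sub_cancel_left]

theorem IsTwistedQuiver.embr_smul (hT : IsTwistedQuiver T k) [∀ A B d, ContinuousConstSMul k (H A B d)] (c : k)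
    (hφ : IsContCochain k p φ) : embr T p (c • φ) = c • embr T p φ := by
  funext M N q e i
  ext j
  refine tendsto_nhds_unique (hT.tendsto_embr (hφ.smul c) q e i j) ?_
  refine ((hT.tendsto_embr hφ q e i j).const_smul c).congr fun n => ?_
  simp only [embrTerm_smul, Pi.smul_apply, DFinsupp.smul_apply, Finset.smul_sum]

theorem IsTwistedQuiver.embr_zero (hT : IsTwistedQuiver T k) (p : ℤ) : embr T p (0 : RawCochain H) = 0 := by
  funext M N q e
  rw [hT.embr_eq_sum (IsContCochain.zero p) q e (L := 0)]
  · rfl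
  · intro m _; rw [embrTerm_zero_cochain]; rfl

variable [∀ A B d, IsTopologicalAddGroup (H A B d)]

theorem IsTwistedQuiver.embr_add (hT : IsTwistedQuiver T k) (hφ : IsContCochain k p φ) (hψ : IsContCochain k p ψ) :
    embr T p (φ + ψ) = embr T p φ + embr T p ψ := by
  funext M N q e i
  ext j
  refine tendsto_nhds_unique (hT.tendsto_embr (hφ.add hψ) q e i j) ?_
  refine ((hT.tendsto_embr hφ q e i j).add (hT.tendsto_embr hψ q e i j)).congr fun n => ?_
  simp only [embrTerm_add, Pi.add_apply, DFinsupp.add_apply, Finset.sum_add_distrib]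

theorem IsTwistedQuiver.isCochain_embr (hT : IsTwistedQuiver T k) [∀ A B d, ContinuousConstSMul k (H A B d)]
    (hφ : IsContCochain k p φ) : IsCochain k p (embr T p φ) := by
  refine isCochain_iff.2 ⟨fun M N q e he => ?_, fun M N e c q q' q'' h => ?_⟩
  · rw [hT.embr_eq_sum hφ q e (L := 0)]
    · rfl
    · exact fun m _ => (hφ.1.embrTerm m).eq_zero _ _ _ _ he
  · funext i
    ext j
    refine tendsto_nhds_unique (hT.tendsto_embr hφ q'' e i j) ?_
    refine ((hT.tendsto_embr hφ q e i j).add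
      ((hT.tendsto_embr hφ q' e i j).const_smul c)).congr fun n => ?_
    rw [Finset.smul_sum, ← Finset.sum_add_distrib]
    refine Finset.sum_congr rfl fun m _ => ?_
    have := (hφ.1.embrTerm (T := T) m).isMultilin M N e c q q' q'' h
    simp only at this
    rw [this]
    rfl

/-- `embr_δ` is compatible with braces of cochains of bounded arity. -/
theorem IsTwistedQuiver.embr_brace_of_vanishes (hT : IsTwistedQuiver T k) (hφ : IsContCochain k p φ) {n n' : ℕ}
    (hn : ∀ A B (r : HPath H A B), n ≤ r.length → φ A B r = 0)
    {ψs : List (ℤ × RawCochain H)} (hψ : ∀ ψ ∈ ψs, IsContCochain k ψ.1 ψ.2)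
    (hn' : ∀ ψ ∈ ψs, ∀ A B (r : HPath H A B), n' ≤ r.length → ψ.2 A B r = 0) :
    embr T (p + (ψs.map Prod.fst).sum) (brace φ ψs)
      = brace (embr T p φ) (ψs.map fun ψ => (ψ.1, embr T ψ.1 ψ.2)) := by
  have hvan : ∀ {m : ℕ} {p : ℤ} {ψ : RawCochain H}, IsContCochain k p ψ →
      (∀ A B (r : HPath H A B), m ≤ r.length → ψ A B r = 0) → ∀ M N e,
      VanishesFrom m fun q => extend T p ψ M N q e := by
    intro m p ψ hψ h M N e q hq
    have := extend_congr (T := T) (p := p) (φ := ψ) (ψ := 0) (q := q)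
      (fun A B r hr => h A B r (by omega)) e
    rw [extend_zero] at this
    exact this
  have hexp : ∀ {m L : ℕ} {p : ℤ} {ψ : RawCochain H}, IsContCochain k p ψ →
      (∀ A B (r : HPath H A B), m ≤ r.length → ψ A B r = 0) → m ≤ L →
      embr T p ψ = expCochain (deltaCochain T) L (extend T p ψ) := by
    intro m L p ψ hψ h hL
    funext M N q e
    exact hT.embr_eq_sum_of_vanishes hψ h q e (by omega)
  funext M N q e
  -- From this length on the brace vanishes, and the same cutoff serves for `φ` and all `ψ_i`.
  set L := n + ψs.length * n' with hL
  have h1 : ∀ Ψ ∈ ψs.map fun ψ => (ψ.1, extend T ψ.1 ψ.2), ∀ M N e,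
      IsMultilin k fun q => Ψ.2 M N q e := by
    intro Ψ h
    obtain ⟨ψ, hm, rfl⟩ := List.mem_map.1 h
    exact (hψ ψ hm).1.extend.isMultilin
  have h2 : ∀ Ψ ∈ ψs.map fun ψ => (ψ.1, extend T ψ.1 ψ.2), ∀ M N e,
      VanishesFrom n' fun q => Ψ.2 M N q e := by
    intro Ψ h
    obtain ⟨ψ, hm, rfl⟩ := List.mem_map.1 h
    exact hvan (hψ ψ hm) (hn' ψ hm)
  have h3 := insertExp_insertSum hasArity_deltaCochain h1 h2 (hφ.1.extend.isMultilin M N e)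
    (hvan hφ hn M N e) (L := L) (by simp [hL]) q
  have h4 : ∀ A B (r : HPath H A B), L ≤ r.length → brace φ ψs A B r = 0 := by
    intro A B r hr
    funext e
    refine VanishesFrom.insertSum (k := k) (fun ψ h A B e r hr => ?_)
      (hφ.1.isMultilin A B e) (fun r hr => ?_) r hr
    · simp only [hn' ψ h A B r hr, Pi.zero_apply]
    · simp only [hn A B r hr, Pi.zero_apply]
  have h5 : (ψs.map fun ψ => (ψ.1, embr T ψ.1 ψ.2))
      = (ψs.map fun ψ => (ψ.1, extend T ψ.1 ψ.2)).map fun Ψ =>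
        (Ψ.1, expCochain (deltaCochain T) L Ψ.2) := by
    rw [List.map_map]
    refine List.map_congr_left fun ψ h => ?_
    -- Needed for `n' ≤ L`; for an empty list there is nothing to compare.
    have hpos : 1 ≤ ψs.length := List.length_pos_of_mem h
    simp only [Function.comp_apply]
    rw [hexp (hψ ψ h) (hn' ψ h) (L := L) (by nlinarith)]
  rw [hexp (hφ.brace hψ) h4 le_rfl, extend_brace hφ.1 fun ψ h => (hψ ψ h).1, h5,
    hexp hφ hn (L := L) (by omega)]
  exact h3

/-- `embr_δ` is compatible with braces. -/
theorem IsTwistedQuiver.embr_brace (hT : IsTwistedQuiver T k) (hφ : IsContCochain k p φ)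
    {ψs : List (ℤ × RawCochain H)} (hψ : ∀ ψ ∈ ψs, IsContCochain k ψ.1 ψ.2) :
    embr T (p + (ψs.map Prod.fst).sum) (brace φ ψs)
      = brace (embr T p φ) (ψs.map fun ψ => (ψ.1, embr T ψ.1 ψ.2)) := by
  have hψt : ∀ n, ∀ ψ ∈ ψs.map fun ψ => (ψ.1, truncate n ψ.2), IsContCochain k ψ.1 ψ.2 := by
    intro n ψ' h
    obtain ⟨ψ, hm, rfl⟩ := List.mem_map.1 h
    exact (hψ ψ hm).truncate n
  have hdeg : ∀ n, ((ψs.map fun ψ => (ψ.1, truncate n ψ.2)).map Prod.fst).sum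
      = (ψs.map Prod.fst).sum := fun n => by
    simp only [List.map_map, Function.comp_def]
  have hconst : ∀ {M N : T} {qs : ℕ → HPath (TwHom T) M N} {q : HPath (TwHom T) M N},
      PathTendsto (fun _ _ _ fs f => fs = fun _ => f) qs q → qs = fun _ => q := by
    intro M N qs q h
    induction h with
    | nil => rfl
    | cons hf _ ih => rw [hf, ih]
  funext M N q e i
  ext j
  set S := embr T (p + (ψs.map Prod.fst).sum) (brace φ ψs) M N q e i j
  -- The double sequence of embedded truncations, with the limits `Z` obtained by removing the
  -- truncation of the `ψ_i` first.
  let W : ℕ → ℕ → H (M.1.obj i) (N.1.obj j) (e + N.1.shift j - M.1.shift i) := fun m n =>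
    brace (embr T p (truncate m φ)) (ψs.map fun ψ => (ψ.1, embr T ψ.1 (truncate n ψ.2)))
      M N q e i j
  let Z : ℕ → H (M.1.obj i) (N.1.obj j) (e + N.1.shift j - M.1.shift i) := fun m =>
    brace (embr T p (truncate m φ)) (ψs.map fun ψ => (ψ.1, embr T ψ.1 ψ.2)) M N q e i j
  have hW : ∀ m n, W m n = embr T (p + (ψs.map Prod.fst).sum)
      (brace (truncate m φ) (ψs.map fun ψ => (ψ.1, truncate n ψ.2))) M N q e i j := by
    intro m n
    have := hT.embr_brace_of_vanishes (hφ.truncate m) (fun A B r => truncate_of_le) (hψt n)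
      (n' := n) (by
        intro ψ' h
        obtain ⟨ψ, h, rfl⟩ := List.mem_map.1 h
        exact fun A B r => truncate_of_le)
    rw [hdeg] at this
    rw [this, List.map_map]
    rfl
  -- With `φ` truncated, `embr` is a finite sum of terms continuous for column-wise convergence, and
  -- the embedded `ψ_i` are column-wise limits of their truncations.
  have hWZ : ∀ m, Tendsto (W m) atTop (𝓝 (Z m)) := by
    intro m
    simp only [W, Z, brace_apply_entry]
    have := tendsto_insertSum (l := atTop) (c := fun _ _ _ fs f => fs = fun _ => f)
      (c' := ColTendsto (T := T) atTop)
      (ψs := ψs.map fun ψ => (ψ.1, fun n => embr T ψ.1 (truncate n ψ.2), embr T ψ.1 ψ.2))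
      (Gs := fun _ r => embr T p (truncate m φ) M N r e i j)
      (G := fun r => embr T p (truncate m φ) M N r e i j)
      (fun _ _ _ fs f h => by rw [h]; exact colTendsto_const f)
      (by
        intro ψ' h A B qs q hq e
        obtain ⟨ψ, hm, rfl⟩ := List.mem_map.1 h
        rw [hconst hq]
        exact hT.colTendsto_embr_truncate (hψ ψ hm) q e)
      (by
        intro rs r hr
        have h1 : ∀ r, embr T p (truncate m φ) M N r e i j
            = ∑ a ∈ Finset.range m, embrTerm T p (truncate m φ) a M N r e i j := fun r => by
          rw [hT.embr_eq_sum_of_vanishes (hφ.truncate m) (fun A B r => truncate_of_le) (L := m) r e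
            (by omega), Finset.sum_apply, DFinsupp.finsetSum_apply]
        simp only [h1]
        exact tendsto_finsetSum _ fun a _ => (hφ.truncate m).tendsto_embrTerm a hr e i j)
      (PathTendsto.const (fun _ _ _ _ => rfl) q)
    simpa only [List.map_map, Function.comp_def] using this
  -- Here the strings fed to `φ` no longer vary, so pointwise convergence suffices.
  have hZ : Tendsto Z atTop (𝓝 (brace (embr T p φ) (ψs.map fun ψ => (ψ.1, embr T ψ.1 ψ.2))
      M N q e i j)) := by
    simp only [Z, brace_apply_entry]
    have := tendsto_insertSum (l := atTop) (c := fun _ _ _ fs f => fs = fun _ => f)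
      (c' := fun _ _ _ fs f => fs = fun _ => f)
      (ψs := ψs.map fun ψ => (ψ.1, fun _ : ℕ => embr T ψ.1 ψ.2, embr T ψ.1 ψ.2))
      (Gs := fun n r => embr T p (truncate n φ) M N r e i j)
      (G := fun r => embr T p φ M N r e i j)
      (fun _ _ _ fs f h => h)
      (by
        intro ψ' h A B qs q hq e
        obtain ⟨ψ, h, rfl⟩ := List.mem_map.1 h
        rw [hconst hq])
      (by
        intro rs r hr
        rw [hconst hr]
        exact (hT.colTendsto_embr_truncate hφ r e i).2 j)
      (PathTendsto.const (fun _ _ _ _ => rfl) q)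
    simpa only [List.map_map, Function.comp_def] using this
  -- On strings shorter than `n` the truncations are invisible: each `ψ_i` lengthens the string by
  -- at most one, hence the margin `ψs.length` for `φ`. The error thus moves to arities at least
  -- `n`, where `embr` tends to zero.
  have hdiag : ∀ a b : ℕ → ℕ, (∀ n, n + ψs.length ≤ a n) → (∀ n, n ≤ b n) →
      Tendsto (fun n => W (a n) (b n)) atTop (𝓝 S) := by
    intro a b ha hb
    have hc : ∀ n, IsContCochain k (p + (ψs.map Prod.fst).sum)
        (brace (truncate (a n) φ) (ψs.map fun ψ => (ψ.1, truncate (b n) ψ.2))) := fun n => by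
      have := (hφ.truncate (a n)).brace (hψt (b n))
      rwa [hdeg] at this
    have h1 := hT.tendsto_embr_zero (fun n => (hφ.brace hψ).sub (hc n)) (by
      intro n A B r hr
      funext e
      rw [Pi.sub_apply, Pi.sub_apply, Pi.sub_apply, Pi.sub_apply, brace_eq_insertSum,
        brace_eq_insertSum, Pi.zero_apply, sub_eq_zero]
      refine insertSum_congr le_rfl ?_ fun s _ hs => ?_
      · refine List.forall₂_map_right_iff.2 (List.forall₂_same.2 fun ψ _ => ⟨rfl, ?_⟩)
        intro A B t e ht
        exact (congrFun (truncate_of_lt (by have := hb n; omega)) e).symm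
      · rw [truncate_of_lt (by have := ha n; omega)]) q e i j
    have h2 : ∀ n, embr T (p + (ψs.map Prod.fst).sum) (brace φ ψs
        - brace (truncate (a n) φ) (ψs.map fun ψ => (ψ.1, truncate (b n) ψ.2))) M N q e i j
        = S - W (a n) (b n) := fun n => by
      rw [eq_sub_iff_add_eq, hW]
      have := hT.embr_add ((hφ.brace hψ).sub (hc n)) (hc n)
      rw [sub_add_cancel] at this
      simp only [S, this]
      rfl
    simp only [h2] at h1
    simpa using (tendsto_const_nhds (x := S)).sub h1
  refine tendsto_nhds_unique ?_ hZ
  by_contra hcon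
  obtain ⟨V, ⟨hV, hVc⟩, hfr⟩ : ∃ V : Set _, (V ∈ 𝓝 S ∧ IsClosed V) ∧ ∃ᶠ n in atTop, Z n ∉ V := by
    by_contra! h
    refine hcon ((closed_nhds_basis S).tendsto_right_iff.2 fun V hV => ?_)
    simpa [Filter.not_frequently] using h V hV
  -- First an index `a` with `Z a` outside the closed set `V`, then `b` so large that `W a b` is
  -- still outside; the resulting sequence contradicts `hdiag`.
  have hstep : ∀ n : ℕ, ∃ a b, n + ψs.length ≤ a ∧ n ≤ b ∧ W a b ∉ V := by
    intro n
    obtain ⟨a, ha, hZa⟩ := (frequently_atTop.1 hfr) (n + ψs.length)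
    obtain ⟨b, hb, hb'⟩ := (((hWZ a).eventually (hVc.isOpen_compl.mem_nhds hZa)).and
      (eventually_ge_atTop n)).exists
    exact ⟨a, b, ha, hb', hb⟩
  choose a b ha hb hab using hstep
  obtain ⟨n, hn⟩ := ((hdiag a b ha hb).eventually hV).exists
  exact hab n hn

end Embr

/-! ### Transport of the structures, and the formulas in low arity. -/

section Structures

variable {Ob : Type u} {H : Ob → Ob → ℤ → Type v} [∀ A B d, AddCommGroup (H A B d)]
  {k : Type*} [CommRing k] [∀ A B d, Module k (H A B d)] {T : Set (TwObj.{u, v, w} H)}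

theorem HasArity.add {n : ℕ} {φ ψ : RawCochain H} (hφ : HasArity n φ) (hψ : HasArity n ψ) :
    HasArity n (φ + ψ) := fun A B q hq => by
  rw [Pi.add_apply, Pi.add_apply, Pi.add_apply, hφ A B q hq, hψ A B q hq, add_zero]

/-- A cochain of arity `n` that agrees with `μ` in arity `n` is a component of `μ`. -/
theorem HasArity.eq_byArity {n : ℕ} {φ μ : RawCochain H} (hφ : HasArity n φ)
    (h : ∀ A B (q : HPath H A B), q.length = n → φ A B q = μ A B q) :
    φ = byArity fun a => if a = n then μ else 0 := by
  funext A B q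
  by_cases hq : q.length = n
  · simp [byArity, hq, h A B q hq]
  · simp [byArity, hq, hφ A B q hq]

theorem HasArity.embrTerm_apply {a m : ℕ} {p : ℤ} {φ : RawCochain H} (hφ : HasArity a φ)
    (hc : IsCochain k p φ) {M N : T} {q : HPath (TwHom T) M N} (h : q.length + m ≠ a) :
    embrTerm T p φ m M N q = 0 := by
  funext e
  rw [embrTerm_congr hc (IsCochain.zero p) (fun A B r hr => hφ A B r (by omega)),
    embrTerm_zero_cochain]
  rfl

theorem HasArity.embrTerm {a m n : ℕ} {p : ℤ} {φ : RawCochain H} (hφ : HasArity a φ)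
    (hc : IsCochain k p φ) (h : n + m = a) : HasArity n (embrTerm T p φ m) :=
  fun _ _ _ hq => hφ.embrTerm_apply hc (by omega)

theorem HasArity.embrTerm_eq_zero {a m : ℕ} {p : ℤ} {φ : RawCochain H} (hφ : HasArity a φ)
    (hc : IsCochain k p φ) (h : a < m) : TwistedObjects.embrTerm T p φ m = 0 := by
  funext M N q
  exact hφ.embrTerm_apply hc (by omega)

variable [∀ A B d, TopologicalSpace (H A B d)]

/-- Only the sum of the components is assumed to be a continuous cochain; a single component
inherits this, being obtained from the sum by deleting the other arities. -/
theorem HasArity.isContCochain {n : ℕ} {p : ℤ} {φ μ : RawCochain H} (hφ : HasArity n φ)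
    (hμ : IsContCochain k p μ)
    (h : ∀ A B (q : HPath H A B), q.length = n → φ A B q = μ A B q) : IsContCochain k p φ := by
  rw [hφ.eq_byArity h]
  refine .byArity fun a => ?_
  split_ifs
  · exact hμ
  · exact .zero p

variable [∀ A B d, T2Space (H A B d)] [∀ A B d, IsTopologicalAddGroup (H A B d)] {p : ℤ} {μ : RawCochain H}

theorem IsTwistedQuiver.isAInftyStructure_embr [∀ A B d, ContinuousConstSMul k (H A B d)]
    (hT : IsTwistedQuiver T k) (hc : IsContinuous μ)
    (hμ : IsAInftyStructure k μ) : IsAInftyStructure k (embr T 1 μ) := by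
  have hμc : IsContCochain k 1 μ := ⟨hμ.1, hc⟩
  refine ⟨hT.isCochain_embr hμc, ?_⟩
  have := hT.embr_brace hμc (ψs := [(1, μ)]) (by simpa using hμc)
  rw [hμ.2, hT.embr_zero] at this
  exact this.symm

theorem IsTwistedQuiver.isBInftyMorphism_embr [∀ A B d, ContinuousConstSMul k (H A B d)]
    (hT : IsTwistedQuiver T k) (hμ : IsContCochain k 1 μ) :
    IsBInftyMorphism k (IsContCochain k) (IsCochain k) μ (embr T 1 μ) (embr T) where
  map_mem p φ hφ := hT.isCochain_embr hφ
  map_add p φ ψ hφ hψ := hT.embr_add hφ hψ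
  map_smul p c φ hφ := hT.embr_smul c hφ
  map_brace p φ ψs hφ hψ := hT.embr_brace hφ hψ
  map_opD φs hφ := by
    match φs, hφ with
    | [], _ => exact hT.embr_zero _
    | [φ], hφ =>
      have hφ' : IsContCochain k φ.1 φ.2 := hφ φ (by simp)
      have h1 := hT.embr_brace hμ hφ
      have h2 := hT.embr_brace hφ' (ψs := [(1, μ)]) (by simpa using hμ)
      have c1 := hμ.brace hφ
      have c2 := hφ'.brace (ψs := [(1, μ)]) (by simpa using hμ)
      simp only [List.map_cons, List.map_nil, List.sum_cons, List.sum_nil, add_zero] at h1 h2 c1 c2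
      -- `embr` is indexed by the degree: `φ{μ}` has degree `|φ| + 1`, which must read `1 + |φ|` to
      -- be combined with `μ{φ}`.
      rw [add_comm] at h2 c2
      simp only [opD, List.map_cons, List.map_nil, List.sum_cons, List.sum_nil, add_zero]
      -- The sign is turned into a scalar of `k`, so that linearity of `embr` applies.
      have h3 : brace μ [φ] - φ.1.negOnePow • brace φ.2 [(1, μ)] = brace μ [φ]
          + (-((φ.1.negOnePow : ℤ) : k)) • brace φ.2 [(1, μ)] := by
        rw [Units.smul_def, neg_smul, Int.cast_smul_eq_zsmul, sub_eq_add_neg]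
      rw [h3, hT.embr_add c1 (c2.smul _), hT.embr_smul _ c2, h1, h2, Units.smul_def, neg_smul,
        Int.cast_smul_eq_zsmul, sub_eq_add_neg]
    | φ :: ψ :: φs, hφ => exact hT.embr_brace hμ hφ

variable {c d m : RawCochain H}

/-- A cochain of arity `a` only has terms with `m ≤ a`, of arity `a - m`, so three terms of the
series suffice; the right side collects them by arity. -/
theorem IsTwistedQuiver.embr_of_hasArity (hT : IsTwistedQuiver T k) (hc : HasArity 0 c)
    (hd : HasArity 1 d) (hm : HasArity 2 m) (hc' : IsContCochain k p c) (hd' : IsContCochain k p d)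
    (hm' : IsContCochain k p m) :
    embr T p (c + d + m)
      = (extend T p c + brace (extend T p d) (deltas T 1) + brace (extend T p m) (deltas T 2))
        + (extend T p d + brace (extend T p m) (deltas T 1)) + extend T p m := by
  have key : ∀ m', embrTerm T p (c + d + m) m'
      = embrTerm T p c m' + embrTerm T p d m' + embrTerm T p m m' := fun m' => by
    rw [embrTerm_add, embrTerm_add]
  have h3 : ∀ m', 3 ≤ m' → embrTerm T p (c + d + m) m' = 0 := fun m' h => by
    rw [key, hc.embrTerm_eq_zero hc'.1 (by omega), hd.embrTerm_eq_zero hd'.1 (by omega),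
      hm.embrTerm_eq_zero hm'.1 (by omega), add_zero, add_zero]
  have hsum : embr T p (c + d + m) = ∑ a ∈ Finset.range 3, embrTerm T p (c + d + m) a := by
    funext M N q e
    rw [hT.embr_eq_sum ((hc'.add hd').add hm') q e (L := 3)]
    · simp only [Finset.sum_apply]
    · intro a ha
      rw [h3 a ha]
      rfl
  change _ = (extend T p c + embrTerm T p d 1 + embrTerm T p m 2)
    + (extend T p d + embrTerm T p m 1) + extend T p m
  rw [hsum, Finset.sum_range_succ, Finset.sum_range_succ, Finset.sum_range_one, key, key, key,
    hc.embrTerm_eq_zero hc'.1 (m := 1) (by omega), hc.embrTerm_eq_zero hc'.1 (m := 2) (by omega),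
    hd.embrTerm_eq_zero hd'.1 (m := 2) (by omega), embrTerm_zero, embrTerm_zero, embrTerm_zero]
  abel

end Structures

end TwistedObjects

/-! ### Assembly of the proposition. -/

theorem mainTheorem9 {k : Type*} [CommRing k] {Ob : Type*} {H : Ob → Ob → ℤ → Type*}
    [∀ A B d, AddCommGroup (H A B d)] [∀ A B d, Module k (H A B d)]
    [∀ A B d, TopologicalSpace (H A B d)] [∀ A B d, IsTopologicalAddGroup (H A B d)]
    [∀ A B d, ContinuousConstSMul k (H A B d)] [∀ A B d, T2Space (H A B d)]
    (T : Set (TwObj H)) (hT : IsTwistedQuiver T k) :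
    -- the series defining `embr_δ` converges pointwise to it
    (∀ (p : ℤ) (φ : RawCochain H), IsContCochain k p φ →
      PointwiseHasSum T (embrTerm T p φ) (embr T p φ)) ∧
    -- transport of `A_[0,∞[`-structures
    (∀ μ : RawCochain H, IsContinuous μ → IsAInftyStructure k μ →
      IsAInftyStructure k (embr T 1 μ) ∧
      IsBInftyMorphism k (IsContCochain k) (IsCochain k) μ (embr T 1 μ) (embr T)) ∧
    -- the cdg case
    (∀ c d m : RawCochain H, HasArity 0 c → HasArity 1 d → HasArity 2 m →
      IsContinuous (c + d + m) → IsCdgStructure k (c + d + m) →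
      embr T 1 (c + d + m)
        = (extend T 1 c + brace (extend T 1 d) (deltas T 1) + brace (extend T 1 m) (deltas T 2))
          + (extend T 1 d + brace (extend T 1 m) (deltas T 1)) + extend T 1 m ∧
      HasArity 0 (extend T 1 c + brace (extend T 1 d) (deltas T 1)
        + brace (extend T 1 m) (deltas T 2)) ∧
      HasArity 1 (extend T 1 d + brace (extend T 1 m) (deltas T 1)) ∧
      HasArity 2 (extend T 1 m) ∧
      IsCdgStructure k (embr T 1 (c + d + m))) ∧
    -- the dg case
    (∀ d m : RawCochain H, HasArity 1 d → HasArity 2 m →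
      IsContinuous (d + m) → IsDgStructure k (d + m) →
      brace (extend T 1 d) (deltas T 1) + brace (extend T 1 m) (deltas T 2) = 0 →
      embr T 1 (d + m)
        = (extend T 1 d + brace (extend T 1 m) (deltas T 1)) + extend T 1 m ∧
      IsDgStructure k (embr T 1 (d + m))) := by
  have cdg : ∀ c d m : RawCochain H, HasArity 0 c → HasArity 1 d → HasArity 2 m →
      IsContinuous (c + d + m) → IsCdgStructure k (c + d + m) →
      embr T 1 (c + d + m)
        = (extend T 1 c + brace (extend T 1 d) (deltas T 1) + brace (extend T 1 m) (deltas T 2))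
          + (extend T 1 d + brace (extend T 1 m) (deltas T 1)) + extend T 1 m ∧
      HasArity 0 (extend T 1 c + brace (extend T 1 d) (deltas T 1)
        + brace (extend T 1 m) (deltas T 2)) ∧
      HasArity 1 (extend T 1 d + brace (extend T 1 m) (deltas T 1)) ∧
      HasArity 2 (extend T 1 m) ∧
      IsCdgStructure k (embr T 1 (c + d + m)) := by
    intro c d m hc hd hm hcont hμ
    have hμ' : IsContCochain k 1 (c + d + m) := ⟨hμ.1.1, hcont⟩
    have hc' : IsContCochain k 1 c := hc.isContCochain hμ' fun A B q hq => by
      simp only [Pi.add_apply, hd A B q (by omega), hm A B q (by omega), add_zero]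
    have hd' : IsContCochain k 1 d := hd.isContCochain hμ' fun A B q hq => by
      simp only [Pi.add_apply, hc A B q (by omega), hm A B q (by omega), add_zero, zero_add]
    have hm' : IsContCochain k 1 m := hm.isContCochain hμ' fun A B q hq => by
      simp only [Pi.add_apply, hc A B q (by omega), hd A B q (by omega), zero_add]
    have h := hT.embr_of_hasArity hc hd hm hc' hd' hm'
    have a0 : HasArity 0 (extend T 1 c + brace (extend T 1 d) (deltas T 1)
        + brace (extend T 1 m) (deltas T 2)) := by
      refine (HasArity.add ?_ (hd.embrTerm hd'.1 (m := 1) rfl)).add (hm.embrTerm hm'.1 (m := 2) rfl)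
      rw [← embrTerm_zero]
      exact hc.embrTerm hc'.1 rfl
    have a1 : HasArity 1 (extend T 1 d + brace (extend T 1 m) (deltas T 1)) := by
      refine HasArity.add ?_ (hm.embrTerm hm'.1 (m := 1) rfl)
      rw [← embrTerm_zero]
      exact hd.embrTerm hd'.1 rfl
    have a2 : HasArity 2 (extend T 1 m) := by
      rw [← embrTerm_zero]
      exact hm.embrTerm hm'.1 rfl
    refine ⟨h, a0, a1, a2, hT.isAInftyStructure_embr hcont hμ.1, fun M N q hq => ?_⟩
    have h' := congrFun (congrFun (congrFun h M) N) q
    rw [h', Pi.add_apply, Pi.add_apply, Pi.add_apply, a2 M N q (by omega)]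
    rw [Pi.add_apply (_ + _ + _) _ M, Pi.add_apply, Pi.add_apply, a0 M N q (by omega),
      a1 M N q (by omega), add_zero, add_zero]
  refine ⟨fun p φ hφ => hT.pointwiseHasSum hφ, fun μ hc hμ =>
    ⟨hT.isAInftyStructure_embr hc hμ, hT.isBInftyMorphism_embr ⟨hμ.1, hc⟩⟩, cdg, ?_⟩
  intro d m hd hm hcont hμ h0
  -- The dg case is the cdg case with zero curvature. The Maurer–Cartan hypothesis removes the
  -- arity-zero part, which leaves only arities `1` and `2`.
  have hz : HasArity 0 (0 : RawCochain H) := fun _ _ _ _ => rfl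
  have hdm : (0 : RawCochain H) + d + m = d + m := by rw [zero_add]
  obtain ⟨h, -, a1, a2, hcdg⟩ := cdg 0 d m hz hd hm (by rwa [hdm]) (by rw [hdm]; exact hμ.1)
  rw [hdm] at h hcdg
  rw [extend_zero, zero_add, h0, zero_add] at h
  refine ⟨h, hcdg, fun M N q hq => ?_⟩
  have h' := congrFun (congrFun (congrFun h M) N) q
  rw [h', Pi.add_apply, Pi.add_apply, Pi.add_apply, a2 M N q (by omega), a1 M N q (by omega),
    add_zero]
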